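/- Conventions. For $f$ on $\mathbb R^n$ let $\hat f(\xi)=\int e^{-ix\cdot\xi}f(x)\,dx$. For real $s>-1$ and $f\in L^1(\mathbb R^n)$ with compact support, let $S^sf(x)=(2\pi)^{-n}\int_{|\xi|<1}(1-|\xi|^2)^s\hat f(\xi)e^{ix\cdot\xi}\,d\xi$ and $\tilde S^sf=\Gamma(s+1)^{-1}S^sf$; for $z\in\mathbb C$, $\tilde S^zf(x)$ is the value at $z$ of the entire function that continues $s\mapsto\tilde S^sf(x)$ analytically. The function $(z+2)\Gamma(z+1)$ is given its limit $-1$ at its removable singularity $z=-2$. Proposition. Let $n\ge 1$, $\frac12<\beta<\frac32$ and $\beta\le\frac{n+1}4$, and put $p=\frac{2n+2}{n+1+4\beta}$ and $q=\frac{2n+2}{n+1-4\beta}$ (with $q=\infty$ if $\beta=\frac{n+1}4$). Then there is a constant $C=C(n,\beta)$ such that for every $\mu\in\mathbb R$ the operator $\tilde S^{-2\beta+i\mu}$ is well defined by this analytic continuation on the compactly supported functions in $L^p(\mathbb R^n)$, extends to a linear operator from $L^p(\mathbb R^n)$ to $L^q(\mathbb R^n)$, and this extension satisfies $$\big\|(2-2\beta+i\mu)\,\Gamma(1-2\beta+i\mu)\,\tilde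 S^{-2\beta+i\mu}f\big\|_{L^q(\mathbb R^n)}\le C\,(1+|\mu|)\,\|f\|_{L^p(\mathbb R^n)}\qquad\text{for all } f\in L^p(\mathbb R^n).$$ -/

import Mathlib

open MeasureTheory Filter Topology
open scoped ENNReal FourierTransform

noncomputable section

/-- The symbol `(1 - |ξ|²)₊ ^ s`, equal to `(1 - |ξ|²) ^ s` in the open unit ball and `0` outside
(also for `s = 0`, where it is the characteristic function of the ball). -/
def bochnerRieszSymbol {n : ℕ} (s : ℝ) (ξ : EuclideanSpace ℝ (Fin n)) : ℝ :=
  (Metric.ball (0 : EuclideanSpace ℝ (Fin n)) 1).indicator (fun ζ => (1 - ‖ζ‖ ^ 2) ^ s) ξ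

/-- The Bochner–Riesz operator `S ^ s`, for real `s > -1`: the Fourier multiplier with symbol
`(1 - |ξ|²)₊ ^ s`, where `ξ` is the angular frequency, dual to `x` through `exp (i x·ξ)`. As
Mathlib's transform `𝓕` uses `exp (-2πi x·η)`, the angular frequency is `ξ = 2πη`. -/
def bochnerRiesz {n : ℕ} (s : ℝ) (f : EuclideanSpace ℝ (Fin n) → ℂ) :
    EuclideanSpace ℝ (Fin n) → ℂ :=
  𝓕⁻ (fun η : EuclideanSpace ℝ (Fin n) =>
    (bochnerRieszSymbol s ((2 * Real.pi) • η) : ℂ) * 𝓕 f η)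

/-- `G` is the entire function of `z` that continues the values at `x` of
`Γ(s+1)⁻¹ S ^ s f`, `s > -1` real. -/
def IsBochnerRieszContinuation {n : ℕ} (f : EuclideanSpace ℝ (Fin n) → ℂ)
    (x : EuclideanSpace ℝ (Fin n)) (G : ℂ → ℂ) : Prop :=
  Differentiable ℂ G ∧
    ∀ s : ℝ, -1 < s → G (s : ℂ) = (Complex.Gamma ((s : ℂ) + 1))⁻¹ * bochnerRiesz s f x

/-- The analytic continuation is unique. -/
theorem IsBochnerRieszContinuation.unique {n : ℕ} {f : EuclideanSpace ℝ (Fin n) → ℂ}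
    {x : EuclideanSpace ℝ (Fin n)} {G H : ℂ → ℂ} (hG : IsBochnerRieszContinuation f x G)
    (hH : IsBochnerRieszContinuation f x H) : G = H := by
  have h0 : Tendsto (fun k : ℕ => (((1 : ℝ) / ((k : ℝ) + 1) : ℝ) : ℂ)) atTop (𝓝[≠] 0) := by
    refine tendsto_nhdsWithin_iff.2 ⟨?_, Eventually.of_forall fun k => ?_⟩
    · have h := (Complex.continuous_ofReal.tendsto 0).comp
        (tendsto_one_div_add_atTop_nhds_zero_nat (𝕜 := ℝ))
      simpa [Function.comp_def] using h
    · have : (0 : ℝ) < 1 / ((k : ℝ) + 1) := by positivity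
      simpa using (Complex.ofReal_ne_zero.2 this.ne')
  refine AnalyticOnNhd.eq_of_frequently_eq (z₀ := 0)
    (fun z _ => hG.1.analyticAt z) (fun z _ => hH.1.analyticAt z) ?_
  refine h0.frequently (Frequently.of_forall fun k => ?_)
  have hk : (-1 : ℝ) < 1 / ((k : ℝ) + 1) := by
    have : (0 : ℝ) < 1 / ((k : ℝ) + 1) := by positivity
    linarith
  rw [hG.2 _ hk, hH.2 _ hk]

/-- `v = S̃ ^ z f`, for the analytic family of Bochner–Riesz operators
`S̃ ^ s = Γ(s+1)⁻¹ S ^ s` (`s > -1`), continued analytically to all complex `z`. -/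
def IsAnalyticBochnerRiesz {n : ℕ} (z : ℂ) (f v : EuclideanSpace ℝ (Fin n) → ℂ) : Prop :=
  ∀ x, ∃ G : ℂ → ℂ, IsBochnerRieszContinuation f x G ∧ v x = G z

/-- The linear operator `T : L^p → L^q` extends `S̃ ^ z`, which is given by analytic continuation
on the compactly supported functions in `L^p`. -/
def ExtendsAnalyticBochnerRiesz {n : ℕ} {p q : ℝ≥0∞} (z : ℂ)
    (T : Lp ℂ p (volume : Measure (EuclideanSpace ℝ (Fin n))) →ₗ[ℂ]
      Lp ℂ q (volume : Measure (EuclideanSpace ℝ (Fin n)))) : Prop :=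
  ∀ (f : EuclideanSpace ℝ (Fin n) → ℂ) (hf : MemLp f p volume), HasCompactSupport f →
    ∃ v, IsAnalyticBochnerRiesz z f v ∧ T (hf.toLp f) =ᵐ[volume] v

/-- The factor `(z + 2) Γ(z + 1)`, with its limit `-1` at the removable singularity `z = -2`. -/
def bochnerRieszFactor (z : ℂ) : ℂ :=
  open Classical in if z = -2 then -1 else (z + 2) * Complex.Gamma (z + 1)

/-- The value `-1` is the limit of `(z + 2) Γ(z + 1)` at `-2`. -/
theorem continuousAt_bochnerRieszFactor : ContinuousAt bochnerRieszFactor (-2) := by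
  have hg : ContinuousAt (fun z : ℂ => Complex.Gamma (z + 3) / (z + 1)) (-2) := by
    have h1 : ContinuousAt Complex.Gamma (-2 + 3) := by
      have : (-2 + 3 : ℂ) = 1 := by norm_num
      rw [this]
      exact Complex.continuousAt_Gamma_one
    have h2 : ContinuousAt (fun z : ℂ => Complex.Gamma (z + 3)) (-2) :=
      ContinuousAt.comp (f := fun z : ℂ => z + 3) h1 (by fun_prop)
    exact h2.div (by fun_prop) (by norm_num)
  refine hg.congr ?_
  have hne : ∀ᶠ z : ℂ in 𝓝 (-2), z ≠ -1 := isOpen_ne.mem_nhds (by norm_num)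
  filter_upwards [hne] with z hz
  have hz1 : z + 1 ≠ 0 := fun h => hz (eq_neg_of_add_eq_zero_left h)
  unfold bochnerRieszFactor
  split_ifs with h
  · subst h
    norm_num
  · have hz2 : z + 2 ≠ 0 := fun h' => h (eq_neg_of_add_eq_zero_left h')
    have e1 : Complex.Gamma (z + 3) = (z + 2) * Complex.Gamma (z + 2) := by
      rw [← Complex.Gamma_add_one _ hz2]; congr 1; ring
    have e2 : Complex.Gamma (z + 2) = (z + 1) * Complex.Gamma (z + 1) := by
      rw [← Complex.Gamma_add_one _ hz1]; congr 1; ring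
    rw [e1, e2]
    field_simp

/-- The exponent `p = (2n+2)/(n+1+4β)`. -/
def sourceExponent (n : ℕ) (β : ℝ) : ℝ≥0∞ :=
  ENNReal.ofReal (2 * n + 2) / ENNReal.ofReal (n + 1 + 4 * β)

/-- The exponent `q = (2n+2)/(n+1-4β)`, which is `∞` for `β = (n+1)/4`. -/
def targetExponent (n : ℕ) (β : ℝ) : ℝ≥0∞ :=
  ENNReal.ofReal (2 * n + 2) / ENNReal.ofReal (n + 1 - 4 * β)

end

/-! The theorem is Stein's interpolation applied to the analytic family $\tilde S^z$. The Fourier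
transform of $(1-|\xi|^2)_+^z$ is $\Gamma(z+1)$ times a constant times the Bessel-type function
`besselClifford (z + n/2 + 1) |x|` (`integral_ballProfile_mul_exp`). Dividing by $\Gamma(z+1)$
leaves a kernel `rieszKernel z` that is entire in $z$ and continuous in $x$, so convolution with it
gives the analytic continuation on integrable functions of compact support
(`isBochnerRieszContinuation_rieszPotential`).

On $\Re z=0$ the symbol has modulus at most $1$, and Plancherel bounds $\Gamma(z+1)\tilde S^z$ on
$L^2$ (`norm_integral_mul_integral_rieszKernel_le`). On $\Re z=-(n+1)/2$ the kernel is bounded in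
$x$, which gives $L^1\to L^\infty$. The growth in $\Im z$ is absorbed by the weight
$H(z)=\Gamma(z+m+1)/(z+n+2)^m$, `interpolationWeight`, chosen so that $|H(z)|\le|\Gamma(z+1)|$ on
the first line while $H(z)$ times the kernel is bounded on the whole closed strip. The kernel bound
rests on one dimension: the same Bessel function is the Fourier transform of $(1-t^2)_+^a$ on
$\mathbb R$ with $a=z+\frac{n-1}2$, and two integrations by parts bound it
(`norm_integral_oscillatory_le`).

The three lines theorem at $w=-2\beta+i\mu$ bounds $H(w)\tilde S^w$ from $L^p$ to its dual $L^q$,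
since $\frac1p=\frac12\bigl(1+\frac{4\beta}{n+1}\bigr)$. Finally $|(w+2)\Gamma(w+1)|\le
C(1+|\mu|)\,|H(w)|$ (`exists_norm_bochnerRieszFactor_le`): both sides carry the same Gamma decay,
and counting linear factors leaves one power of $1+|\mu|$. Density extends the operator to all of
$L^p$. -/

noncomputable section

open Module (finrank)
open scoped SchwartzMap

/-! ### Radial moments of the symbol as Beta integrals -/

/-- The profile `(1 - r²)₊ ^ z` of the Bochner–Riesz symbol with complex exponent. -/
def ballProfile (z : ℂ) (r : ℝ) : ℂ := if r < 1 then ((1 - r ^ 2 : ℝ) : ℂ) ^ z else 0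

/-- The substitution $u=x^2$ turns the radial moment into a Beta integrand. The last term corrects
the single point $x=1$, where the indicator of `Set.Ioc 0 1` is not zero and `0 ^ z` need not
vanish; it disappears almost everywhere. -/
lemma ballProfile_weight_eq {z : ℂ} {a x : ℝ} (hx : 0 < x) :
    ((x ^ (a - 1) : ℝ) : ℂ) * ballProfile z x = ((2 : ℝ)⁻¹ : ℂ) * ((2 * x ^ ((2 : ℝ) - 1)) •
      ((Set.Ioc (0 : ℝ) 1).indicator
        (fun u : ℝ => (u : ℂ) ^ ((a / 2 : ℂ) - 1) * (1 - (u : ℂ)) ^ (z + 1 - 1)) (x ^ (2 : ℝ))) +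
      if x = 1 then - (2 * x ^ ((2 : ℝ) - 1)) • ((0 : ℂ) ^ z) else 0) := by
  have h2 : x ^ (2 : ℝ) = x ^ 2 := by norm_cast
  rcases lt_trichotomy x 1 with h | h | h
  · have hmem : x ^ (2 : ℝ) ∈ Set.Ioc (0 : ℝ) 1 := by
      rw [h2]; constructor
      · positivity
      · nlinarith
    rw [Set.indicator_of_mem hmem, if_neg h.ne, ballProfile, if_pos h, h2]
    have e1 : ((x ^ 2 : ℝ) : ℂ) ^ ((a / 2 : ℂ) - 1) = ((x ^ (a - 2) : ℝ) : ℂ) := by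
      have : ((a / 2 : ℂ) - 1) = ((a / 2 - 1 : ℝ) : ℂ) := by push_cast; ring
      rw [this, ← Complex.ofReal_cpow (by positivity), ← Real.rpow_natCast, ← Real.rpow_mul hx.le]
      congr 2; push_cast; ring
    have e2 : x ^ ((2 : ℝ) - 1) = x := by norm_num
    have e3 : x ^ (a - 1) = x * x ^ (a - 2) := by
      rw [show a - 1 = 1 + (a - 2) by ring, Real.rpow_add hx, Real.rpow_one]
    rw [e1, e2, e3, add_sub_cancel_right, Complex.real_smul]
    push_cast
    ring
  · subst h
    simp [ballProfile]
  · have hmem : x ^ (2 : ℝ) ∉ Set.Ioc (0 : ℝ) 1 := by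
      rw [h2]; intro hh
      nlinarith [hh.2]
    rw [Set.indicator_of_notMem hmem, if_neg h.ne', ballProfile, if_neg h.not_gt]
    simp

lemma ballProfile_weight_ae (z : ℂ) (a : ℝ) :
    (fun x : ℝ => ((x ^ (a - 1) : ℝ) : ℂ) * ballProfile z x) =ᵐ[volume.restrict (Set.Ioi 0)]
    fun x => ((2 : ℝ)⁻¹ : ℂ) * ((2 * x ^ ((2 : ℝ) - 1)) •
      ((Set.Ioc (0 : ℝ) 1).indicator
        (fun u : ℝ => (u : ℂ) ^ ((a / 2 : ℂ) - 1) * (1 - (u : ℂ)) ^ (z + 1 - 1)) (x ^ (2 : ℝ)))) := by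
  have h1 : ∀ᵐ x : ℝ ∂(volume.restrict (Set.Ioi 0)), x ≠ 1 :=
    ae_restrict_of_ae (by simp [ae_iff])
  filter_upwards [ae_restrict_mem measurableSet_Ioi, h1] with x hx hx1
  rw [ballProfile_weight_eq hx, if_neg hx1, add_zero]

lemma integrableOn_ballProfile_weight {z : ℂ} {a : ℝ} (hz : -1 < z.re) (ha : 0 < a) :
    IntegrableOn (fun x : ℝ => ((x ^ (a - 1) : ℝ) : ℂ) * ballProfile z x) (Set.Ioi 0) := by
  have hc := Complex.betaIntegral_convergent (u := (a / 2 : ℂ)) (v := z + 1)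
    (by rw [show (a / 2 : ℂ) = ((a / 2 : ℝ) : ℂ) by push_cast; ring, Complex.ofReal_re]; linarith)
    (by simp; linarith)
  rw [intervalIntegrable_iff_integrableOn_Ioc_of_le zero_le_one] at hc
  have hi := (integrable_indicator_iff measurableSet_Ioc).2 hc
  have h2 := (integrableOn_Ioi_comp_rpow_iff _ (two_ne_zero (α := ℝ))).2
    (hi.integrableOn (s := Set.Ioi (0 : ℝ)))
  refine Integrable.congr ?_ (ballProfile_weight_ae z a).symm
  simp only [abs_two] at h2
  exact h2.const_mul _

lemma integral_ballProfile_weight {z : ℂ} {a : ℝ} (hz : -1 < z.re) (ha : 0 < a) :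
    ∫ x in Set.Ioi (0 : ℝ), ((x ^ (a - 1) : ℝ) : ℂ) * ballProfile z x =
      (2 : ℂ)⁻¹ * (Complex.Gamma (a / 2) * Complex.Gamma (z + 1) *
        (Complex.Gamma (a / 2 + z + 1))⁻¹) := by
  have ha' : 0 < ((a / 2 : ℂ)).re := by
    rw [show (a / 2 : ℂ) = ((a / 2 : ℝ) : ℂ) by push_cast; ring, Complex.ofReal_re]; linarith
  have hz' : 0 < (z + 1).re := by simp; linarith
  rw [integral_congr_ae (ballProfile_weight_ae z a), integral_const_mul,
    integral_comp_rpow_Ioi_of_pos (g := (Set.Ioc (0 : ℝ) 1).indicator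
        (fun u : ℝ => (u : ℂ) ^ ((a / 2 : ℂ) - 1) * (1 - (u : ℂ)) ^ (z + 1 - 1))) two_pos,
    setIntegral_indicator measurableSet_Ioc,
    Set.inter_eq_right.2 (fun x hx => hx.1), ← intervalIntegral.integral_of_le zero_le_one]
  have := Complex.betaIntegral_eq_Gamma_mul_div _ _ ha' hz'
  rw [Complex.betaIntegral] at this
  rw [this, add_assoc]
  push_cast
  rw [div_eq_mul_inv (Complex.Gamma _ * _)]

lemma hasSum_of_forall_eq {f g : ℕ → ℂ} {a : ℂ} (h : HasSum g a) (e : ∀ k, f k = g k) :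
    HasSum f a := by
  rwa [show f = g from funext e]

/-- Since $Bt\le\frac12(t^2+B^2)$, half of the Gaussian absorbs the exponential. This is the
majorant for expanding $e^{c\,x\cdot\xi}$ termwise under the Gaussian. -/
lemma integrable_exp_neg_sq_mul_exp {V : Type*} [NormedAddCommGroup V] [InnerProductSpace ℝ V]
    [FiniteDimensional ℝ V] [MeasurableSpace V] [BorelSpace V] (B : ℝ) :
    Integrable (fun ξ : V => Real.exp (-‖ξ‖ ^ 2) * Real.exp (B * ‖ξ‖)) := by
  have h := GaussianFourier.integrable_cexp_neg_mul_sq_norm_add (V := V) (b := 1 / 2)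
    (by norm_num) 0 0
  refine (h.norm.const_mul (Real.exp (B ^ 2 / 2))).mono' (by fun_prop)
    (Eventually.of_forall fun ξ => ?_)
  rw [Real.norm_of_nonneg (by positivity), Complex.norm_exp, ← Real.exp_add, ← Real.exp_add]
  refine Real.exp_le_exp.2 ?_
  have : (-(1 / 2 : ℂ) * (‖ξ‖ : ℂ) ^ 2 + 0 * ((inner ℝ 0 ξ : ℝ) : ℂ)).re = -(1 / 2) * ‖ξ‖ ^ 2 := by
    rw [show (-(1 / 2 : ℂ) * (‖ξ‖ : ℂ) ^ 2 + 0 * ((inner ℝ 0 ξ : ℝ) : ℂ)) =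
      ((-(1 / 2) * ‖ξ‖ ^ 2 : ℝ) : ℂ) by push_cast; ring, Complex.ofReal_re]
  rw [this]
  nlinarith [sq_nonneg (B - ‖ξ‖)]

lemma abs_inner_pow_le {V : Type*} [NormedAddCommGroup V] [InnerProductSpace ℝ V] (x ξ : V) (k : ℕ) : ‖((inner ℝ x ξ : ℝ) : ℂ) ^ k‖ ≤ (‖x‖ * ‖ξ‖) ^ k := by
  rw [norm_pow, Complex.norm_real]
  exact pow_le_pow_left₀ (norm_nonneg _) (norm_inner_le_norm x ξ) k

/-! ### The Fourier transform of the symbol, through Gaussian moments -/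

section Polar

variable {V : Type*} [NormedAddCommGroup V] [InnerProductSpace ℝ V] [FiniteDimensional ℝ V]
  [MeasurableSpace V] [BorelSpace V] [Nontrivial V]

/-- Integration in polar coordinates of a radial function times a power of a linear form. -/
lemma integral_radial_mul_inner_pow (g : ℝ → ℂ) (x : V) (k : ℕ) :
    ∫ ξ : V, g ‖ξ‖ * ((inner ℝ x ξ : ℝ) : ℂ) ^ k =
      (∫ ω, ((inner ℝ x (ω : V) : ℝ) : ℂ) ^ k ∂(volume : Measure V).toSphere) *
      ∫ r in Set.Ioi (0 : ℝ), ((r ^ ((k + finrank ℝ V : ℕ) - 1 : ℝ) : ℝ) : ℂ) * g r := by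
  calc
    ∫ ξ : V, g ‖ξ‖ * ((inner ℝ x ξ : ℝ) : ℂ) ^ k
      = ∫ ξ : ({(0)}ᶜ : Set V), g ‖ξ.1‖ * ((inner ℝ x ξ.1 : ℝ) : ℂ) ^ k
          ∂((volume : Measure V).comap (↑)) := by
      rw [integral_subtype_comap (measurableSet_singleton _).compl
        fun ξ : V => g ‖ξ‖ * ((inner ℝ x ξ : ℝ) : ℂ) ^ k, restrict_compl_singleton]
    _ = ∫ p, ((inner ℝ x (p.1 : V) : ℝ) : ℂ) ^ k * (((p.2 : ℝ) : ℂ) ^ k * g p.2)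
          ∂(volume : Measure V).toSphere.prod (.volumeIoiPow (finrank ℝ V - 1)) := by
      rw [← (Measure.measurePreserving_homeomorphUnitSphereProd (volume : Measure V)).integral_comp
        (Homeomorph.measurableEmbedding _)]
      refine integral_congr_ae (Eventually.of_forall fun ξ => ?_)
      have h0 : ‖ξ.1‖ ≠ 0 := norm_ne_zero_iff.2 ξ.2
      simp only [homeomorphUnitSphereProd_apply_snd_coe, homeomorphUnitSphereProd_apply_fst_coe,
        real_inner_smul_right]
      have h1 : ((‖ξ.1‖ : ℝ) : ℂ) ≠ 0 := Complex.ofReal_ne_zero.2 h0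
      push_cast
      rw [mul_pow, inv_pow]
      field_simp
    _ = _ := by
      rw [integral_prod_mul (fun ω : Metric.sphere (0 : V) 1 => ((inner ℝ x (ω : V) : ℝ) : ℂ) ^ k)
        (fun r : Set.Ioi (0 : ℝ) => ((r : ℝ) : ℂ) ^ k * g r)]
      congr 1
      simp only [Measure.volumeIoiPow, ENNReal.ofReal]
      rw [integral_withDensity_eq_integral_smul,
        integral_subtype_comap measurableSet_Ioi fun a : ℝ =>
          Real.toNNReal (a ^ (finrank ℝ V - 1)) • ((a : ℂ) ^ k * g a),
        setIntegral_congr_fun measurableSet_Ioi fun r hr => ?_]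
      · have hr0 : 0 < r := hr
        rw [NNReal.smul_def, Real.coe_toNNReal _ (pow_nonneg hr0.le _), Complex.real_smul,
          ← mul_assoc]
        congr 1
        rw [show ((k + finrank ℝ V : ℕ) - 1 : ℝ) = ((k + (finrank ℝ V - 1) : ℕ) : ℝ) by
          have : 1 ≤ finrank ℝ V := Module.finrank_pos
          push_cast [Nat.cast_sub this]; ring, Real.rpow_natCast]
        push_cast
        ring
      · exact (measurable_subtype_coe.pow_const _).real_toNNReal

/-- The moments of the Gaussian. -/
def gaussianMoment (x : V) (k : ℕ) : ℂ :=
  ∫ ξ : V, Complex.exp (-‖ξ‖ ^ 2) * ((inner ℝ x ξ : ℝ) : ℂ) ^ k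

lemma integral_exp_neg_sq_weight {a : ℝ} (ha : 0 < a) :
    ∫ r in Set.Ioi (0 : ℝ), ((r ^ (a - 1) : ℝ) : ℂ) * Complex.exp (-(r : ℂ) ^ 2) =
      (2 : ℂ)⁻¹ * Complex.Gamma (a / 2) := by
  have h := integral_rpow_mul_exp_neg_rpow (p := 2) (q := a - 1) two_pos (by linarith)
  have e : ∀ r : ℝ, ((r ^ (a - 1) : ℝ) : ℂ) * Complex.exp (-(r : ℂ) ^ 2) =
      ((r ^ (a - 1) * Real.exp (-r ^ (2 : ℝ)) : ℝ) : ℂ) := by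
    intro r
    push_cast
    norm_num
  simp_rw [e]
  rw [integral_complex_ofReal, h]
  push_cast
  rw [← Complex.Gamma_ofReal]
  push_cast
  norm_num

/-- The moments of `(1 - |ξ|²)₊ ^ z` in terms of those of the Gaussian. -/
lemma integral_ballProfile_mul_inner_pow {z : ℂ} (hz : -1 < z.re) (x : V) (k : ℕ) :
    ∫ ξ : V, ballProfile z ‖ξ‖ * ((inner ℝ x ξ : ℝ) : ℂ) ^ k =
      gaussianMoment x k * Complex.Gamma (z + 1) *
        (Complex.Gamma (((k + finrank ℝ V : ℕ) : ℂ) / 2 + z + 1))⁻¹ := by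
  have hd : 0 < finrank ℝ V := Module.finrank_pos
  have ha : (0 : ℝ) < ((k + finrank ℝ V : ℕ) : ℝ) := by positivity
  -- The integral over the sphere is the same for both radial functions, so only the quotient of the
  -- two radial integrals matters and the spherical moments need not be computed.
  rw [integral_radial_mul_inner_pow, integral_ballProfile_weight hz ha, gaussianMoment,
    integral_radial_mul_inner_pow (fun r : ℝ => Complex.exp (-(r : ℂ) ^ 2)), integral_exp_neg_sq_weight ha]
  push_cast
  ring

lemma integrable_ballProfile {z : ℂ} (hz : -1 < z.re) :
    Integrable (fun ξ : V => ballProfile z ‖ξ‖) := by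
  rw [integrable_fun_norm_addHaar]
  have hd : 0 < finrank ℝ V := Module.finrank_pos
  have := integrableOn_ballProfile_weight (z := z) (a := finrank ℝ V) hz (by positivity)
  refine this.congr_fun (fun r hr => ?_) measurableSet_Ioi
  simp only [Complex.real_smul]
  congr 2
  rw [← Nat.cast_pred hd, Real.rpow_natCast]

omit [Nontrivial V] in
-- The known Gaussian integral with a linear term, expanded in powers of $c$: a generating function
-- for the moments.
lemma hasSum_gaussianMoment (x : V) (c : ℂ) :
    HasSum (fun k : ℕ => c ^ k / (k.factorial : ℂ) * gaussianMoment x k)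
      ((Real.pi : ℂ) ^ (finrank ℝ V / 2 : ℂ) * Complex.exp (c ^ 2 * ‖x‖ ^ 2 / 4)) := by
  have h := GaussianFourier.integral_cexp_neg_mul_sq_norm_add (V := V) (b := 1) (by norm_num) c x
  rw [div_one, mul_one] at h
  rw [← h]
  simp only [gaussianMoment, ← integral_const_mul]
  have hexp : ∀ t : ℝ, HasSum (fun k : ℕ => t ^ k / (k.factorial : ℝ)) (Real.exp t) := fun t => by
    rw [Real.exp_eq_exp_ℝ]; exact NormedSpace.expSeries_div_hasSum_exp t
  have hbs : ∀ ξ : V, HasSum (fun k : ℕ => Real.exp (-‖ξ‖ ^ 2) *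
      ((‖c‖ * ‖x‖ * ‖ξ‖) ^ k / (k.factorial : ℝ)))
      (Real.exp (-‖ξ‖ ^ 2) * Real.exp (‖c‖ * ‖x‖ * ‖ξ‖)) := fun ξ => (hexp _).mul_left _
  refine hasSum_integral_of_dominated_convergence
    (fun k ξ => Real.exp (-‖ξ‖ ^ 2) * ((‖c‖ * ‖x‖ * ‖ξ‖) ^ k / (k.factorial : ℝ)))
    (fun k => by fun_prop) (fun k => Eventually.of_forall fun ξ => ?_)
    (Eventually.of_forall fun ξ => (hbs ξ).summable) ?_ (Eventually.of_forall fun ξ => ?_)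
  · rw [norm_mul, norm_mul, norm_div, norm_pow, Complex.norm_natCast, Complex.norm_exp]
    have e : (-(‖ξ‖ : ℂ) ^ 2).re = -‖ξ‖ ^ 2 := by
      rw [show (-(‖ξ‖ : ℂ) ^ 2) = ((-‖ξ‖ ^ 2 : ℝ) : ℂ) by push_cast; ring, Complex.ofReal_re]
    rw [e, show (‖c‖ * ‖x‖ * ‖ξ‖) ^ k = ‖c‖ ^ k * (‖x‖ * ‖ξ‖) ^ k by rw [← mul_pow]; ring]
    have := abs_inner_pow_le x ξ k
    calc _ ≤ ‖c‖ ^ k / (k.factorial : ℝ) * (Real.exp (-‖ξ‖ ^ 2) * (‖x‖ * ‖ξ‖) ^ k) := by gcongr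
      _ = _ := by ring
  · simp_rw [(hbs _).tsum_eq]
    exact integrable_exp_neg_sq_mul_exp _
  · rw [Complex.exp_add]
    have h1 : HasSum (fun k : ℕ => (c * ((inner ℝ x ξ : ℝ) : ℂ)) ^ k / (k.factorial : ℂ))
        (Complex.exp (c * ((inner ℝ x ξ : ℝ) : ℂ))) := by
      rw [Complex.exp_eq_exp_ℂ]; exact NormedSpace.expSeries_div_hasSum_exp _
    refine hasSum_of_forall_eq (h1.mul_left (Complex.exp (-1 * (‖ξ‖ : ℂ) ^ 2))) fun k => ?_
    rw [mul_pow, neg_one_mul]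
    ring

/-- Coefficients of an everywhere convergent power series are determined by its sum. -/
lemma coeff_unique {a b : ℕ → ℂ} {f : ℂ → ℂ} (ha : ∀ c : ℂ, HasSum (fun k => c ^ k * a k) (f c))
    (hb : ∀ c : ℂ, HasSum (fun k => c ^ k * b k) (f c)) (k : ℕ) : a k = b k := by
  have key : ∀ u : ℕ → ℂ, (∀ c : ℂ, HasSum (fun k => c ^ k * u k) (f c)) →
      HasFPowerSeriesAt f (FormalMultilinearSeries.ofScalars ℂ u) 0 := fun u hu => by
    rw [hasFPowerSeriesAt_iff]
    refine Eventually.of_forall fun c => ?_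
    simpa [FormalMultilinearSeries.coeff_ofScalars] using hu c
  have := (key a ha).eq_formalMultilinearSeries (key b hb)
  simpa [FormalMultilinearSeries.coeff_ofScalars] using
    congrArg (fun p : FormalMultilinearSeries ℂ ℂ ℂ => p.coeff k) this

omit [Nontrivial V] in
lemma gaussianMoment_eq (x : V) (k : ℕ) :
    gaussianMoment x k = if Even k then (Real.pi : ℂ) ^ (finrank ℝ V / 2 : ℂ) *
      (k.factorial * (‖x‖ ^ 2 / 4) ^ (k / 2) / (k / 2).factorial) else 0 := by
  have hb : ∀ c : ℂ, HasSum (fun k : ℕ => c ^ k * (if Even k then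
      (Real.pi : ℂ) ^ (finrank ℝ V / 2 : ℂ) * ((‖x‖ ^ 2 / 4) ^ (k / 2) / (k / 2).factorial) else 0))
      ((Real.pi : ℂ) ^ (finrank ℝ V / 2 : ℂ) * Complex.exp (c ^ 2 * ‖x‖ ^ 2 / 4)) := fun c => by
    rw [← (mul_right_injective₀ (two_ne_zero (α := ℕ))).hasSum_iff]
    · have h1 : HasSum (fun k : ℕ => (c ^ 2 * ‖x‖ ^ 2 / 4) ^ k / (k.factorial : ℂ))
          (Complex.exp (c ^ 2 * ‖x‖ ^ 2 / 4)) := by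
        rw [Complex.exp_eq_exp_ℂ]; exact NormedSpace.expSeries_div_hasSum_exp _
      refine hasSum_of_forall_eq (h1.mul_left ((Real.pi : ℂ) ^ (finrank ℝ V / 2 : ℂ))) fun k => ?_
      simp only [Function.comp_apply, even_two, Even.mul_right, if_true,
        Nat.mul_div_cancel_left _ two_pos]
      rw [mul_div_assoc, mul_pow, pow_mul]
      ring
    · intro m hm
      rw [if_neg, mul_zero]
      rintro ⟨j, rfl⟩
      exact hm ⟨j, by simp [two_mul]⟩
  have ha : ∀ c : ℂ, HasSum (fun k : ℕ => c ^ k * (gaussianMoment x k / k.factorial))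
      ((Real.pi : ℂ) ^ (finrank ℝ V / 2 : ℂ) * Complex.exp (c ^ 2 * ‖x‖ ^ 2 / 4)) := fun c => by
    convert hasSum_gaussianMoment x c using 1
    ext k; ring
  have h := coeff_unique ha hb k
  have hk : (k.factorial : ℂ) ≠ 0 := by exact_mod_cast k.factorial_ne_zero
  rw [div_eq_iff hk] at h
  rw [h]
  split_ifs
  · ring
  · simp

/-- The Bessel–Clifford type function `∑ (-r²/4)^j / (j! Γ(w+j))`, which is
`(r/2)^(1-w) J_(w-1)(r)`. -/
def besselClifford (w : ℂ) (r : ℝ) : ℂ :=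
  ∑' j : ℕ, ((-(r ^ 2 / 4) : ℝ) : ℂ) ^ j / (j.factorial : ℂ) * (Complex.Gamma (w + j))⁻¹

/-- The Fourier transform of `(1 - |ξ|²)₊ ^ z`. -/
lemma integral_ballProfile_mul_exp {z : ℂ} (hz : -1 < z.re) (x : V) :
    ∫ ξ : V, ballProfile z ‖ξ‖ * Complex.exp (Complex.I * ((inner ℝ x ξ : ℝ) : ℂ)) =
      Complex.Gamma (z + 1) * (Real.pi : ℂ) ^ (finrank ℝ V / 2 : ℂ) *
        besselClifford (z + finrank ℝ V / 2 + 1) ‖x‖ := by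
  have hsum : HasSum (fun k : ℕ => ∫ ξ : V, Complex.I ^ k / (k.factorial : ℂ) *
      (ballProfile z ‖ξ‖ * ((inner ℝ x ξ : ℝ) : ℂ) ^ k))
      (∫ ξ : V, ballProfile z ‖ξ‖ * Complex.exp (Complex.I * ((inner ℝ x ξ : ℝ) : ℂ))) := by
    -- The profile vanishes for $|\xi|\ge1$, so $|x\cdot\xi|\le|x|$ wherever it matters and
    -- $e^{|x|}$ dominates the exponential series.
    have hexp : HasSum (fun k : ℕ => ‖x‖ ^ k / (k.factorial : ℝ)) (Real.exp ‖x‖) := by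
      rw [Real.exp_eq_exp_ℝ]; exact NormedSpace.expSeries_div_hasSum_exp _
    have hbs : ∀ ξ : V, HasSum (fun k : ℕ => ‖ballProfile z ‖ξ‖‖ *
        (‖x‖ ^ k / (k.factorial : ℝ))) (‖ballProfile z ‖ξ‖‖ * Real.exp ‖x‖) :=
      fun ξ => hexp.mul_left _
    refine hasSum_integral_of_dominated_convergence
      (fun k ξ => ‖ballProfile z ‖ξ‖‖ * (‖x‖ ^ k / (k.factorial : ℝ)))
      (fun k => ?_) (fun k => Eventually.of_forall fun ξ => ?_)
      (Eventually.of_forall fun ξ => (hbs ξ).summable) ?_ (Eventually.of_forall fun ξ => ?_)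
    · refine AEStronglyMeasurable.const_mul (AEStronglyMeasurable.mul ?_ (by fun_prop)) _
      exact (integrable_ballProfile hz).1
    · rw [norm_mul, norm_mul, norm_div, norm_pow, Complex.norm_I, one_pow, Complex.norm_natCast]
      by_cases h : ‖ξ‖ < 1
      · have h1 : ‖((inner ℝ x ξ : ℝ) : ℂ) ^ k‖ ≤ ‖x‖ ^ k :=
          (abs_inner_pow_le x ξ k).trans (pow_le_pow_left₀ (by positivity)
            (mul_le_of_le_one_right (norm_nonneg _) h.le) k)
        calc _ ≤ 1 / (k.factorial : ℝ) * (‖ballProfile z ‖ξ‖‖ * ‖x‖ ^ k) := by gcongr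
          _ = _ := by ring
      · simp [ballProfile, h]
    · simp_rw [(hbs _).tsum_eq]
      exact (integrable_ballProfile hz).norm.mul_const _
    · have h1 : HasSum (fun k : ℕ => (Complex.I * ((inner ℝ x ξ : ℝ) : ℂ)) ^ k / (k.factorial : ℂ))
          (Complex.exp (Complex.I * ((inner ℝ x ξ : ℝ) : ℂ))) := by
        rw [Complex.exp_eq_exp_ℂ]; exact NormedSpace.expSeries_div_hasSum_exp _
      refine hasSum_of_forall_eq (h1.mul_left (ballProfile z ‖ξ‖)) fun k => ?_
      rw [mul_pow]
      ring
  simp_rw [integral_const_mul, integral_ballProfile_mul_inner_pow hz, gaussianMoment_eq] at hsum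
  -- Odd moments vanish; the terms $k=2j$ are those of the Bessel–Clifford series.
  rw [← (mul_right_injective₀ (two_ne_zero (α := ℕ))).hasSum_iff] at hsum
  · rw [← hsum.tsum_eq, besselClifford, ← tsum_mul_left]
    refine tsum_congr fun j => ?_
    simp only [Function.comp_apply, even_two, Even.mul_right, if_true,
      Nat.mul_div_cancel_left _ two_pos]
    have hk : ((2 * j).factorial : ℂ) ≠ 0 := by exact_mod_cast (2 * j).factorial_ne_zero
    have e1 : ((2 * j + finrank ℝ V : ℕ) : ℂ) / 2 + z + 1 = z + finrank ℝ V / 2 + 1 + j := by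
      push_cast; ring
    rw [e1, pow_mul, Complex.I_sq]
    push_cast
    rw [neg_pow ((‖x‖ : ℂ) ^ 2 / 4)]
    field_simp
  · intro m hm
    rw [if_neg]
    · simp
    · rintro ⟨j, rfl⟩
      exact hm ⟨j, by simp [two_mul]⟩

end Polar

/-! ### Regularity of the Bessel–Clifford function in order and argument -/

/-- Compactness covers $j\le K$. Beyond $K\ge R+1$ one has $|w+j|\ge1$, and
$1/\Gamma(s)=s/\Gamma(s+1)$ shows that $|1/\Gamma(w+j)|$ no longer increases with $j$. -/
lemma exists_norm_inv_Gamma_add_nat_le (R : ℝ) :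
    ∃ M : ℝ, ∀ w : ℂ, ‖w‖ ≤ R → ∀ j : ℕ, ‖(Complex.Gamma (w + j))⁻¹‖ ≤ M := by
  obtain ⟨K, hK⟩ := exists_nat_ge (R + 1)
  obtain ⟨M, hM⟩ := (isCompact_closedBall (0 : ℂ) (R + K)).exists_bound_of_continuousOn
    Complex.differentiable_one_div_Gamma.continuous.continuousOn
  have hball : ∀ w : ℂ, ‖w‖ ≤ R → ∀ j : ℕ, j ≤ K → ‖(Complex.Gamma (w + j))⁻¹‖ ≤ M := by
    intro w hw j hj
    refine hM _ ?_
    rw [mem_closedBall_zero_iff]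
    refine (norm_add_le _ _).trans (add_le_add hw ?_)
    rw [Complex.norm_natCast]
    exact_mod_cast hj
  refine ⟨M, fun w hw j => ?_⟩
  rcases le_total j K with hj | hj
  · exact hball w hw j hj
  · induction j, hj using Nat.le_induction with
    | base => exact hball w hw K le_rfl
    | succ j hj ih =>
      have h1 : 1 ≤ ‖w + j‖ := by
        have h2 : ‖(j : ℂ)‖ ≤ ‖w + j‖ + ‖w‖ := by
          simpa using norm_sub_le (w + j) w
        rw [Complex.norm_natCast] at h2
        have h3 : (K : ℝ) ≤ j := by exact_mod_cast hj
        linarith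
      rw [Complex.one_div_Gamma_eq_self_mul_one_div_Gamma_add_one, norm_mul] at ih
      push_cast
      rw [← add_assoc]
      exact (le_mul_of_one_le_left (norm_nonneg _) h1).trans ih

/-- Domination by an exponential series, uniform on bounded sets of $(w,r)$; joint continuity and
holomorphy in $w$ both follow from it. -/
lemma exists_summable_bound_besselClifford (R : ℝ) :
    ∃ u : ℕ → ℝ, Summable u ∧ ∀ w : ℂ, ‖w‖ ≤ R → ∀ r : ℝ, |r| ≤ R → ∀ j : ℕ,
      ‖((-(r ^ 2 / 4) : ℝ) : ℂ) ^ j / (j.factorial : ℂ) * (Complex.Gamma (w + j))⁻¹‖ ≤ u j := by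
  obtain ⟨M, hM⟩ := exists_norm_inv_Gamma_add_nat_le R
  refine ⟨fun j => (R ^ 2 / 4) ^ j / (j.factorial : ℝ) * M,
    (Real.summable_pow_div_factorial _).mul_right M, fun w hw r hr j => ?_⟩
  rw [norm_mul, norm_div, norm_pow, Complex.norm_real, Complex.norm_natCast, norm_neg,
    Real.norm_of_nonneg (by positivity)]
  have h1 : r ^ 2 ≤ R ^ 2 := sq_le_sq' (by linarith [neg_abs_le r]) ((le_abs_self r).trans hr)
  change _ ≤ (R ^ 2 / 4) ^ j / (j.factorial : ℝ) * M
  gcongr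
  exact hM w hw j

lemma continuous_besselClifford : Continuous fun p : ℂ × ℝ => besselClifford p.1 p.2 := by
  rw [continuous_iff_continuousAt]
  rintro ⟨w₀, r₀⟩
  set R : ℝ := max ‖w₀‖ |r₀| + 1 with hR
  obtain ⟨u, hu, hb⟩ := exists_summable_bound_besselClifford R
  have hopen : IsOpen {p : ℂ × ℝ | ‖p.1‖ < R ∧ |p.2| < R} :=
    (isOpen_lt (f := fun p : ℂ × ℝ => ‖p.1‖) (g := fun _ => R) (by fun_prop) (by fun_prop)).inter
      (isOpen_lt (f := fun p : ℂ × ℝ => |p.2|) (g := fun _ => R) (by fun_prop) (by fun_prop))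
  refine ContinuousOn.continuousAt (s := {p : ℂ × ℝ | ‖p.1‖ < R ∧ |p.2| < R}) ?_
    (hopen.mem_nhds ⟨?_, ?_⟩)
  · refine continuousOn_tsum (fun j => Continuous.continuousOn ?_) hu
      fun j p hp => hb p.1 hp.1.le p.2 hp.2.le j
    have := Complex.differentiable_one_div_Gamma.continuous.comp
      (show Continuous fun p : ℂ × ℝ => p.1 + j by fun_prop)
    exact Continuous.mul (by fun_prop) this
  · exact (le_max_left _ _).trans_lt (lt_add_one _)
  · exact (le_max_right _ _).trans_lt (lt_add_one _)

lemma differentiable_besselClifford (r : ℝ) :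
    Differentiable ℂ fun w : ℂ => besselClifford w r := by
  intro w₀
  set R : ℝ := max ‖w₀‖ |r| + 1 with hR
  obtain ⟨u, hu, hb⟩ := exists_summable_bound_besselClifford R
  have hr : |r| ≤ R := (le_max_right _ _).trans (le_add_of_nonneg_right zero_le_one)
  have h : DifferentiableOn ℂ (fun w : ℂ => besselClifford w r) (Metric.ball 0 R) := by
    refine Complex.differentiableOn_tsum_of_summable_norm hu (fun j => ?_) Metric.isOpen_ball
      fun j w hw => hb w (mem_ball_zero_iff.1 hw).le r hr j
    have := Complex.differentiable_one_div_Gamma.comp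
      (show Differentiable ℂ fun w : ℂ => w + j by fun_prop)
    exact (this.const_mul _).differentiableOn
  refine h.differentiableAt (Metric.isOpen_ball.mem_nhds ?_)
  rw [mem_ball_zero_iff]
  exact (le_max_left _ _).trans_lt (lt_add_one _)

/-! ### Uniform bounds for the one-dimensional oscillatory integral -/

section Oscillatory

lemma norm_one_sub_sq_cpow_le {α : ℝ} {a : ℂ} (ha : α ≤ a.re) {t : ℝ} (h0 : 0 ≤ t)
    (h1 : t < 1) : ‖((1 - t ^ 2 : ℝ) : ℂ) ^ a‖ ≤ (1 - t ^ 2) ^ α := by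
  have hp : 0 < 1 - t ^ 2 := by nlinarith
  rw [Complex.norm_cpow_eq_rpow_re_of_pos hp]
  exact Real.rpow_le_rpow_of_exponent_ge hp (by nlinarith) ha

lemma hasDerivAt_one_sub_sq_cpow (a : ℂ) {t : ℝ} (h0 : 0 ≤ t) (h1 : t < 1) :
    HasDerivAt (fun t : ℝ => ((1 - t ^ 2 : ℝ) : ℂ) ^ a)
      (a * ((1 - t ^ 2 : ℝ) : ℂ) ^ (a - 1) * ((-(2 * t) : ℝ) : ℂ)) t := by
  have hp : 0 < 1 - t ^ 2 := by nlinarith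
  have h : HasDerivAt (fun t : ℝ => 1 - t ^ 2) (-(2 * t)) t := by
    simpa using (hasDerivAt_pow 2 t).const_sub 1
  exact (Complex.hasStrictDerivAt_cpow_const
    (Complex.ofReal_mem_slitPlane.2 hp)).hasDerivAt.comp t h.ofReal_comp

lemma hasDerivAt_cexp_mul_I (θ t : ℝ) :
    HasDerivAt (fun t : ℝ => Complex.exp (Complex.I * ((θ * t : ℝ) : ℂ)))
      (Complex.exp (Complex.I * ((θ * t : ℝ) : ℂ)) * (Complex.I * θ)) t := by
  have h : HasDerivAt (fun t : ℝ => Complex.I * ((θ * t : ℝ) : ℂ)) (Complex.I * θ) t := by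
    have h1 : HasDerivAt (fun t : ℝ => θ * t) θ t := by simpa using (hasDerivAt_id t).const_mul θ
    exact h1.ofReal_comp.const_mul _
  exact h.cexp

lemma norm_cexp_I_mul_ofReal (x : ℝ) : ‖Complex.exp (Complex.I * (x : ℂ))‖ = 1 := by
  rw [mul_comm, Complex.norm_exp_ofReal_mul_I]

/-- Away from the singularity $t=1$ the exponential is integrated by parts. Each boundary term is at
most $1/(|\theta|(1-b))$; in the remaining integral $2t(1-t^2)^{-2}$ is an exact derivative and
contributes $|a|$ times the same quantity. -/
lemma norm_integral_far_le {a : ℂ} (ha : -1 < a.re) {θ b : ℝ} (hθ : θ ≠ 0) (hb0 : 0 ≤ b)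
    (hb1 : b < 1) :
    ‖∫ t in (0 : ℝ)..b, ((1 - t ^ 2 : ℝ) : ℂ) ^ a * Complex.exp (Complex.I * ((θ * t : ℝ) : ℂ))‖ ≤
      (2 + ‖a‖) / (|θ| * (1 - b)) := by
  have hδ : 0 < 1 - b := by linarith
  have hθ' : 0 < |θ| := abs_pos.2 hθ
  have hiθ : Complex.I * (θ : ℂ) ≠ 0 :=
    mul_ne_zero Complex.I_ne_zero (Complex.ofReal_ne_zero.2 hθ)
  have hmem : ∀ t ∈ Set.uIcc 0 b, 0 ≤ t ∧ t < 1 := fun t ht => by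
    rw [Set.uIcc_of_le hb0] at ht; exact ⟨ht.1, ht.2.trans_lt hb1⟩
  have hpos : ∀ t ∈ Set.uIcc 0 b, 0 < 1 - t ^ 2 := fun t ht => by
    nlinarith [(hmem t ht).1, (hmem t ht).2]
  have hcont : ∀ c : ℂ, ContinuousOn (fun t : ℝ => ((1 - t ^ 2 : ℝ) : ℂ) ^ c) (Set.uIcc 0 b) :=
    fun c t ht => (hasDerivAt_one_sub_sq_cpow c (hmem t ht).1
      (hmem t ht).2).continuousAt.continuousWithinAt
  have hv : ∀ t ∈ Set.uIcc 0 b, HasDerivAt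
      (fun t : ℝ => Complex.exp (Complex.I * ((θ * t : ℝ) : ℂ)) / (Complex.I * θ))
      (Complex.exp (Complex.I * ((θ * t : ℝ) : ℂ))) t := fun t _ => by
    have := (hasDerivAt_cexp_mul_I θ t).div_const (Complex.I * θ)
    rwa [mul_div_cancel_right₀ _ hiθ] at this
  rw [intervalIntegral.integral_mul_deriv_eq_deriv_mul
    (fun t ht => hasDerivAt_one_sub_sq_cpow a (hmem t ht).1 (hmem t ht).2) hv
    (((continuousOn_const.mul (hcont _)).mul (by fun_prop)).intervalIntegrable)
    ((by fun_prop : Continuous fun t : ℝ =>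
      Complex.exp (Complex.I * ((θ * t : ℝ) : ℂ))).intervalIntegrable _ _)]
  have hnv : ∀ t : ℝ, ‖Complex.exp (Complex.I * ((θ * t : ℝ) : ℂ)) / (Complex.I * θ)‖ =
      1 / |θ| := fun t => by
    rw [norm_div, norm_cexp_I_mul_ofReal, norm_mul, Complex.norm_I, one_mul, Complex.norm_real,
      Real.norm_eq_abs]
  have hbd : (1 - b ^ 2)⁻¹ ≤ (1 - b)⁻¹ := inv_anti₀ hδ (by nlinarith)
  have h1 : ‖((1 - b ^ 2 : ℝ) : ℂ) ^ a * (Complex.exp (Complex.I * ((θ * b : ℝ) : ℂ)) /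
      (Complex.I * θ))‖ ≤ (1 - b)⁻¹ / |θ| := by
    rw [norm_mul, hnv, mul_one_div]
    gcongr
    refine (norm_one_sub_sq_cpow_le ha.le hb0 hb1).trans ?_
    rwa [Real.rpow_neg_one]
  have h2 : ‖((1 - (0 : ℝ) ^ 2 : ℝ) : ℂ) ^ a * (Complex.exp (Complex.I * ((θ * 0 : ℝ) : ℂ)) /
      (Complex.I * θ))‖ ≤ (1 - b)⁻¹ / |θ| := by
    rw [norm_mul, hnv, mul_one_div]
    gcongr
    simp only [ne_eq, OfNat.ofNat_ne_zero, not_false_eq_true, zero_pow, sub_zero,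
      Complex.ofReal_one, Complex.one_cpow, norm_one]
    exact (one_le_inv₀ hδ).2 (by linarith)
  have hderiv : ∀ t ∈ Set.uIcc 0 b, HasDerivAt (fun t : ℝ => (1 - t ^ 2)⁻¹)
      (2 * t * (1 - t ^ 2) ^ (-2 : ℝ)) t := fun t ht => by
    have h : HasDerivAt (fun t : ℝ => 1 - t ^ 2) (-(2 * t)) t := by
      simpa using (hasDerivAt_pow 2 t).const_sub 1
    refine (h.inv (hpos t ht).ne').congr_deriv ?_
    rw [Real.rpow_neg (hpos t ht).le, neg_neg, div_eq_mul_inv]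
    norm_cast
  have hint : IntervalIntegrable (fun t : ℝ => 2 * t * (1 - t ^ 2) ^ (-2 : ℝ)) volume 0 b := by
    refine ContinuousOn.intervalIntegrable fun t ht => ContinuousAt.continuousWithinAt ?_
    exact ContinuousAt.mul (by fun_prop)
      (ContinuousAt.rpow_const (by fun_prop) (Or.inl (hpos t ht).ne'))
  have h3 : ‖∫ t in (0 : ℝ)..b, a * ((1 - t ^ 2 : ℝ) : ℂ) ^ (a - 1) * ((-(2 * t) : ℝ) : ℂ) *
      (Complex.exp (Complex.I * ((θ * t : ℝ) : ℂ)) / (Complex.I * θ))‖ ≤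
      ‖a‖ * ((1 - b)⁻¹ / |θ|) := by
    calc _ ≤ ∫ t in (0 : ℝ)..b, ‖a‖ / |θ| * (2 * t * (1 - t ^ 2) ^ (-2 : ℝ)) := by
          refine intervalIntegral.norm_integral_le_of_norm_le hb0
            (Eventually.of_forall fun t ht => ?_) (hint.const_mul _)
          have ht0 : 0 ≤ t := ht.1.le
          have ht1 : t < 1 := ht.2.trans_lt hb1
          rw [norm_mul, hnv, norm_mul, norm_mul, Complex.norm_real, norm_neg,
            Real.norm_of_nonneg (by positivity)]
          have := norm_one_sub_sq_cpow_le (α := -2) (a := a - 1) (by simp; linarith) ht0 ht1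
          calc _ ≤ ‖a‖ * (1 - t ^ 2) ^ (-2 : ℝ) * (2 * t) * (1 / |θ|) := by gcongr
            _ = _ := by ring
      _ = ‖a‖ / |θ| * ((1 - b ^ 2)⁻¹ - 1) := by
          rw [intervalIntegral.integral_const_mul,
            intervalIntegral.integral_eq_sub_of_hasDerivAt hderiv hint]
          norm_num
      _ ≤ ‖a‖ / |θ| * (1 - b)⁻¹ := by gcongr; linarith
      _ = _ := by ring
  refine (norm_sub_le _ _).trans ((add_le_add ((norm_sub_le _ _).trans (add_le_add h1 h2))
    h3).trans (le_of_eq ?_))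
  field_simp
  ring

lemma norm_integral_half_le {a : ℂ} (ha : -1 < a.re) (θ : ℝ) :
    ‖∫ t in (0 : ℝ)..(1 / 2), ((1 - t ^ 2 : ℝ) : ℂ) ^ a *
      Complex.exp (Complex.I * ((θ * t : ℝ) : ℂ))‖ ≤ 1 := by
  have := intervalIntegral.norm_integral_le_of_norm_le_const (a := 0) (b := 1 / 2) (C := 2)
    (f := fun t : ℝ => ((1 - t ^ 2 : ℝ) : ℂ) ^ a * Complex.exp (Complex.I * ((θ * t : ℝ) : ℂ)))
    fun t ht => by
      rw [Set.uIoc_of_le (by norm_num)] at ht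
      rw [norm_mul, norm_cexp_I_mul_ofReal, mul_one]
      refine (norm_one_sub_sq_cpow_le ha.le ht.1.le (by linarith [ht.2])).trans ?_
      rw [Real.rpow_neg_one]
      exact inv_le_of_inv_le₀ (by norm_num) (by nlinarith [ht.1, ht.2])
  refine this.trans (le_of_eq ?_)
  rw [abs_of_nonneg] <;> norm_num

lemma integrableOn_one_sub_sq_cpow {a : ℂ} (ha : -1 < a.re) :
    IntegrableOn (fun t : ℝ => ((1 - t ^ 2 : ℝ) : ℂ) ^ a) (Set.Ioc 0 1) := by
  have h := (integrableOn_ballProfile_weight (z := a) (a := 1) ha one_pos).mono_set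
    (t := Set.Ioi 0) (s := Set.Ioo 0 1) fun t ht => ht.1
  rw [integrableOn_Ioc_iff_integrableOn_Ioo]
  refine h.congr_fun (fun t ht => ?_) measurableSet_Ioo
  simp [ballProfile, ht.2]

/-- Near $t=1$ the power is integrated instead:
$(a+1)(1-t^2)^a=-\frac1{2t}\frac{d}{dt}(1-t^2)^{a+1}$. The factor $a+1$ removes the loss as
$a\to-1$, the boundary term at $1$ vanishes because $\Re(a+1)>0$, and $b\ge\frac12$ controls
$1/(2t)$. -/
lemma norm_integral_near_le {a : ℂ} (ha : -1 < a.re) {θ b : ℝ} (hb0 : 1 / 2 ≤ b) (hb1 : b < 1) :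
    ‖(a + 1) * ∫ t in b..1, ((1 - t ^ 2 : ℝ) : ℂ) ^ a *
      Complex.exp (Complex.I * ((θ * t : ℝ) : ℂ))‖ ≤ 2 + |θ| * (1 - b) := by
  have ha1 : 0 < (a + 1).re := by simp; linarith
  have ha1' : a + 1 ≠ 0 := fun h => by rw [h] at ha1; simp at ha1
  have hmem : ∀ t ∈ Set.uIcc b 1, 1 / 2 ≤ t ∧ t ≤ 1 := fun t ht => by
    rw [Set.uIcc_of_le hb1.le] at ht; exact ⟨hb0.trans ht.1, ht.2⟩
  have hmem' : ∀ t ∈ Set.Ioo (min b 1) (max b 1), 1 / 2 ≤ t ∧ t < 1 := fun t ht => by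
    rw [min_eq_left hb1.le, max_eq_right hb1.le] at ht; exact ⟨hb0.trans ht.1.le, ht.2⟩
  set u : ℝ → ℂ := fun t => ((1 - t ^ 2 : ℝ) : ℂ) ^ (a + 1) with hu
  set v : ℝ → ℂ := fun t => Complex.exp (Complex.I * ((θ * t : ℝ) : ℂ)) * ((2 * t : ℝ) : ℂ)⁻¹
    with hv
  set v' : ℝ → ℂ := fun t => Complex.exp (Complex.I * ((θ * t : ℝ) : ℂ)) * (Complex.I * θ) *
      ((2 * t : ℝ) : ℂ)⁻¹ + Complex.exp (Complex.I * ((θ * t : ℝ) : ℂ)) *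
      (-(2 : ℝ) / ((2 * t : ℝ) : ℂ) ^ 2) with hv'
  set u' : ℝ → ℂ := fun t => (a + 1) * ((1 - t ^ 2 : ℝ) : ℂ) ^ (a + 1 - 1) * ((-(2 * t) : ℝ) : ℂ)
    with hu'
  have hub : ∀ t ∈ Set.uIcc b 1, ‖u t‖ ≤ 1 := fun t ht => by
    have h1 : 0 ≤ 1 - t ^ 2 := by nlinarith [hmem t ht]
    rw [hu]
    simp only []
    rw [Complex.norm_cpow_eq_rpow_re_of_nonneg h1 ha1.ne']
    exact Real.rpow_le_one h1 (by nlinarith [hmem t ht]) ha1.le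
  have hucont : ContinuousOn u (Set.uIcc b 1) := by
    refine Continuous.continuousOn ?_
    exact (Complex.continuous_ofReal_cpow_const ha1).comp (by fun_prop)
  have hvd : ∀ t ∈ Set.uIcc b 1, HasDerivAt v (v' t) t := fun t ht => by
    have h0 : t ≠ 0 := by have := (hmem t ht).1; intro h; rw [h] at this; norm_num at this
    have h2 : HasDerivAt (fun t : ℝ => 2 * t) 2 t := by simpa using (hasDerivAt_id t).const_mul 2
    exact (hasDerivAt_cexp_mul_I θ t).mul (h2.ofReal_comp.inv
      (Complex.ofReal_ne_zero.2 (mul_ne_zero two_ne_zero h0)))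
  have hne : ∀ t ∈ Set.uIcc b 1, ((2 * t : ℝ) : ℂ) ≠ 0 := fun t ht => by
    have := (hmem t ht).1
    exact Complex.ofReal_ne_zero.2 (by positivity)
  have hv'cont : ContinuousOn v' (Set.uIcc b 1) := by
    rw [hv']
    refine ContinuousOn.add (ContinuousOn.mul (by fun_prop) (ContinuousOn.inv₀ (by fun_prop) hne))
      (ContinuousOn.mul (by fun_prop) (ContinuousOn.div (by fun_prop) (by fun_prop)
        fun t ht => pow_ne_zero 2 (hne t ht)))
  have hφ : IntervalIntegrable (fun t : ℝ => ((1 - t ^ 2 : ℝ) : ℂ) ^ a) volume b 1 := by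
    rw [intervalIntegrable_iff_integrableOn_Ioc_of_le hb1.le]
    exact (integrableOn_one_sub_sq_cpow ha).mono_set (Set.Ioc_subset_Ioc_left (by linarith))
  have hu'int : IntervalIntegrable u' volume b 1 := by
    rw [hu', add_sub_cancel_right]
    exact (hφ.const_mul (a + 1)).mul_continuousOn (by fun_prop)
  have hparts := intervalIntegral.integral_mul_deriv_eq_deriv_mul_of_hasDerivAt
    hucont (fun t ht => (hvd t ht).continuousAt.continuousWithinAt)
    (fun t ht => hasDerivAt_one_sub_sq_cpow (a + 1) (by linarith [hmem' t ht]) (hmem' t ht).2)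
    (fun t ht => hvd t (Set.Ioo_subset_Icc_self ht)) hu'int hv'cont.intervalIntegrable
  have heq : (a + 1) * ∫ t in b..1, ((1 - t ^ 2 : ℝ) : ℂ) ^ a *
      Complex.exp (Complex.I * ((θ * t : ℝ) : ℂ)) = -∫ t in b..1, u' t * v t := by
    rw [← intervalIntegral.integral_const_mul, ← intervalIntegral.integral_neg]
    refine intervalIntegral.integral_congr fun t ht => ?_
    have h0 : (t : ℂ) ≠ 0 := fun h => hne t ht (by push_cast; rw [h, mul_zero])
    simp only [hu', hv, add_sub_cancel_right]
    push_cast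
    field_simp
  have hu1 : u 1 = 0 := by simp [hu, Complex.zero_cpow ha1']
  have hval : -∫ t in b..1, u' t * v t = u b * v b + ∫ t in b..1, u t * v' t := by
    rw [hparts, hu1]; ring
  rw [heq, hval]
  have hvb : ‖v b‖ ≤ 1 := by
    rw [hv]
    simp only []
    rw [norm_mul, norm_cexp_I_mul_ofReal, one_mul, norm_inv, Complex.norm_real,
      Real.norm_of_nonneg (by linarith)]
    exact inv_le_one_of_one_le₀ (by linarith)
  have hv'b : ∀ t ∈ Set.uIcc b 1, ‖v' t‖ ≤ |θ| + 2 := fun t ht => by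
    have ht' := (hmem t ht).1
    have ht0 : 0 < t := by linarith
    rw [hv']
    simp only []
    refine (norm_add_le _ _).trans (add_le_add ?_ ?_)
    · rw [norm_mul, norm_mul, norm_cexp_I_mul_ofReal, one_mul, norm_mul, Complex.norm_I, one_mul,
        norm_inv, Complex.norm_real, Complex.norm_real, Real.norm_eq_abs,
        Real.norm_of_nonneg (by linarith)]
      exact mul_le_of_le_one_right (abs_nonneg _) (inv_le_one_of_one_le₀ (by linarith))
    · rw [norm_mul, norm_cexp_I_mul_ofReal, one_mul, norm_div, norm_pow, Complex.norm_real,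
        norm_neg, Complex.norm_real, Real.norm_of_nonneg (zero_le_two (α := ℝ)),
        Real.norm_of_nonneg (by linarith)]
      rw [div_le_iff₀ (by positivity)]
      nlinarith
  have hint : ‖∫ t in b..1, u t * v' t‖ ≤ (|θ| + 2) * |1 - b| :=
    intervalIntegral.norm_integral_le_of_norm_le_const fun t ht => by
      have ht' := Set.uIoc_subset_uIcc ht
      rw [norm_mul]
      calc _ ≤ 1 * (|θ| + 2) := by
            gcongr
            · exact hub t ht'
            · exact hv'b t ht'
        _ = _ := one_mul _
  rw [abs_of_pos (by linarith : (0 : ℝ) < 1 - b)] at hint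
  calc _ ≤ 1 * 1 + (|θ| + 2) * (1 - b) := by
        refine (norm_add_le _ _).trans (add_le_add ?_ hint)
        rw [norm_mul]
        exact mul_le_mul (hub b Set.left_mem_uIcc) hvb (norm_nonneg _) zero_le_one
    _ ≤ _ := by nlinarith

/-- The oscillatory integral `∫₀¹ (1-t²)^a e^{iθt} dt`, uniformly in the frequency. -/
lemma norm_integral_oscillatory_le {a : ℂ} {T : ℝ} (ha : -1 < a.re) (hT : 2 ≤ T) (haT : ‖a‖ ≤ T)
    (haT' : ‖a + 1‖ ≤ T) (θ : ℝ) :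
    ‖(a + 1) * ∫ t in (0 : ℝ)..1, ((1 - t ^ 2 : ℝ) : ℂ) ^ a *
      Complex.exp (Complex.I * ((θ * t : ℝ) : ℂ))‖ ≤ 5 * T := by
  have hint : IntegrableOn (fun t : ℝ => ((1 - t ^ 2 : ℝ) : ℂ) ^ a *
      Complex.exp (Complex.I * ((θ * t : ℝ) : ℂ))) (Set.Ioc 0 1) := by
    refine (integrableOn_one_sub_sq_cpow ha).mul_bdd (c := 1)
      (Continuous.aestronglyMeasurable (by fun_prop)) (Eventually.of_forall fun t => ?_)
    rw [norm_cexp_I_mul_ofReal]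
  have hsplit : ∀ b : ℝ, 1 / 2 ≤ b → b < 1 → ‖(a + 1) * ∫ t in (0 : ℝ)..1,
      ((1 - t ^ 2 : ℝ) : ℂ) ^ a * Complex.exp (Complex.I * ((θ * t : ℝ) : ℂ))‖ ≤
      T * ‖∫ t in (0 : ℝ)..b, ((1 - t ^ 2 : ℝ) : ℂ) ^ a *
        Complex.exp (Complex.I * ((θ * t : ℝ) : ℂ))‖ + (2 + |θ| * (1 - b)) := by
    intro b hb0 hb1
    rw [← intervalIntegral.integral_add_adjacent_intervals (b := b), mul_add]
    · refine (norm_add_le _ _).trans (add_le_add ?_ (norm_integral_near_le ha hb0 hb1))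
      rw [norm_mul]
      gcongr
    · rw [intervalIntegrable_iff_integrableOn_Ioc_of_le (by linarith)]
      exact hint.mono_set (Set.Ioc_subset_Ioc_right hb1.le)
    · rw [intervalIntegrable_iff_integrableOn_Ioc_of_le hb1.le]
      exact hint.mono_set (Set.Ioc_subset_Ioc_left (by linarith))
  -- For low frequencies the cut $b=\frac12$ suffices. For high ones $1-b=T/|\theta|$ makes the near
  -- part $O(T)$, while the far part, multiplied by $|a+1|\le T$, is at most $2+|a|$.
  rcases le_or_gt |θ| (2 * T) with h | h
  · refine (hsplit (1 / 2) le_rfl (by norm_num)).trans ?_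
    have := norm_integral_half_le ha θ
    nlinarith
  · have hθ0 : 0 < |θ| := by linarith
    have hTθ : T / |θ| < 1 / 2 := by rw [div_lt_iff₀ hθ0]; linarith
    have hTθ0 : 0 < T / |θ| := by positivity
    have hprod : |θ| * (T / |θ|) = T := by field_simp
    refine (hsplit (1 - T / |θ|) (by linarith) (by linarith)).trans ?_
    have hfar := norm_integral_far_le ha (b := 1 - T / |θ|) (abs_pos.1 hθ0) (by linarith)
      (by linarith)
    rw [sub_sub_cancel, hprod] at hfar ⊢
    have h2 : T * ((2 + ‖a‖) / T) = 2 + ‖a‖ := by field_simp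
    have := mul_le_mul_of_nonneg_left hfar (by linarith : (0 : ℝ) ≤ T)
    rw [h2] at this
    linarith

lemma integral_ballProfile_real_eq {a : ℂ} (ha : -1 < a.re) (r : ℝ) :
    ∫ ξ : ℝ, ballProfile a ‖ξ‖ * Complex.exp (Complex.I * ((inner ℝ r ξ : ℝ) : ℂ)) =
      (∫ t in (0 : ℝ)..1, ((1 - t ^ 2 : ℝ) : ℂ) ^ a *
        Complex.exp (Complex.I * ((-r * t : ℝ) : ℂ))) +
      ∫ t in (0 : ℝ)..1, ((1 - t ^ 2 : ℝ) : ℂ) ^ a *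
        Complex.exp (Complex.I * ((r * t : ℝ) : ℂ)) := by
  have hint : Integrable fun ξ : ℝ =>
      ballProfile a ‖ξ‖ * Complex.exp (Complex.I * ((inner ℝ r ξ : ℝ) : ℂ)) := by
    refine (integrable_ballProfile ha).mul_bdd (c := 1)
      (Continuous.aestronglyMeasurable (by fun_prop)) (Eventually.of_forall fun t => ?_)
    rw [norm_cexp_I_mul_ofReal]
  have key : ∀ θ : ℝ, ∫ t in Set.Ioi (0 : ℝ), ballProfile a t *
      Complex.exp (Complex.I * ((θ * t : ℝ) : ℂ)) = ∫ t in (0 : ℝ)..1, ((1 - t ^ 2 : ℝ) : ℂ) ^ a *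
        Complex.exp (Complex.I * ((θ * t : ℝ) : ℂ)) := fun θ => by
    rw [intervalIntegral.integral_of_le zero_le_one, integral_Ioc_eq_integral_Ioo,
      ← integral_indicator measurableSet_Ioo, ← integral_indicator measurableSet_Ioi]
    congr 1
    ext t
    by_cases h0 : 0 < t <;> by_cases h1 : t < 1 <;> simp [Set.indicator, ballProfile, h0, h1]
  rw [← integral_add_compl measurableSet_Iic hint, Set.compl_Iic]
  congr 1
  · rw [← key, ← neg_zero, ← integral_comp_neg_Iic]
    refine setIntegral_congr_fun measurableSet_Iic fun t ht => ?_
    have : ‖t‖ = -t := by rw [Real.norm_eq_abs, abs_of_nonpos (by simpa using ht)]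
    simp [this, mul_comm]
  · rw [← key]
    refine setIntegral_congr_fun measurableSet_Ioi fun t ht => ?_
    have : ‖t‖ = t := by rw [Real.norm_eq_abs, abs_of_pos ht]
    simp [this, mul_comm]

/-- The Fourier transform formula on $V=\mathbb R$ writes the Bessel function as an oscillatory
integral. The two half-lines have frequencies $\mp r$ and contribute $5T$ each; the factor
$\sqrt\pi\ge1$ is dropped. -/
lemma norm_Gamma_mul_besselClifford_le_of_lt {a : ℂ} {T : ℝ} (ha : -1 < a.re) (hT : 2 ≤ T)
    (haT : ‖a‖ ≤ T) (haT' : ‖a + 1‖ ≤ T) {r : ℝ} (hr : 0 ≤ r) :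
    ‖Complex.Gamma (a + 2) * besselClifford (a + 3 / 2) r‖ ≤ 10 * T := by
  have ha1' : a + 1 ≠ 0 := fun h => by
    have := congrArg Complex.re h
    simp at this
    linarith
  have h := integral_ballProfile_mul_exp ha r
  rw [integral_ballProfile_real_eq ha, Module.finrank_self, Real.norm_of_nonneg hr] at h
  have hG : Complex.Gamma (a + 2) = (a + 1) * Complex.Gamma (a + 1) := by
    rw [← Complex.Gamma_add_one _ ha1']; congr 1; ring
  have e1 : a + ((1 : ℕ) : ℂ) / 2 + 1 = a + 3 / 2 := by push_cast; ring
  rw [e1] at h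
  have hpi : 1 ≤ ‖(Real.pi : ℂ) ^ (((1 : ℕ) : ℂ) / 2)‖ := by
    rw [Complex.norm_cpow_eq_rpow_re_of_pos Real.pi_pos]
    refine Real.one_le_rpow (by linarith [Real.pi_gt_three]) ?_
    simp
  calc ‖Complex.Gamma (a + 2) * besselClifford (a + 3 / 2) r‖
      ≤ ‖(Real.pi : ℂ) ^ (((1 : ℕ) : ℂ) / 2)‖ *
        ‖Complex.Gamma (a + 2) * besselClifford (a + 3 / 2) r‖ :=
        le_mul_of_one_le_left (norm_nonneg _) hpi
    _ = ‖(a + 1) * (Complex.Gamma (a + 1) * (Real.pi : ℂ) ^ (((1 : ℕ) : ℂ) / 2) *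
        besselClifford (a + 3 / 2) r)‖ := by
        rw [← norm_mul, hG]; congr 1; ring
    _ ≤ 5 * T + 5 * T := by
        rw [← h, mul_add]
        exact (norm_add_le _ _).trans (add_le_add
          (norm_integral_oscillatory_le ha hT haT haT' _)
          (norm_integral_oscillatory_le ha hT haT haT' _))
    _ = 10 * T := by ring

/-- The Bessel function, weighted by `Γ`, is bounded on the half-line by a linear function of the
order, up to and including the line on which it has the decay `r ^ (-1/2)`. -/
lemma norm_Gamma_mul_besselClifford_le {a : ℂ} {T : ℝ} (ha : -1 ≤ a.re) (hT : 2 ≤ T)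
    (haT : ‖a‖ ≤ T) (haT' : ‖a + 1‖ ≤ T) {r : ℝ} (hr : 0 ≤ r) :
    ‖Complex.Gamma (a + 2) * besselClifford (a + 3 / 2) r‖ ≤ 10 * T := by
  have hcontG : ContinuousAt (fun ε : ℝ => Complex.Gamma (a + ε + 2)) 0 := by
    have h1 : ContinuousAt Complex.Gamma (a + (0 : ℝ) + 2) := by
      refine (Complex.differentiableAt_Gamma _ fun m hm => ?_).continuousAt
      have := congrArg Complex.re hm
      simp at this
      have : (0 : ℝ) ≤ m := Nat.cast_nonneg m
      linarith
    exact ContinuousAt.comp (f := fun ε : ℝ => a + ε + 2) h1 (by fun_prop)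
  have hcontB : Continuous (fun ε : ℝ => besselClifford (a + ε + 3 / 2) r) :=
    (differentiable_besselClifford r).continuous.comp (by fun_prop)
  -- The integral diverges on $\Re a=-1$, but both sides of the bound at $a+\varepsilon$ are
  -- continuous as $\varepsilon\downarrow0$, with $T+\varepsilon$ in place of $T$.
  have hlim : Tendsto (fun ε : ℝ => ‖Complex.Gamma (a + ε + 2) * besselClifford (a + ε + 3 / 2) r‖)
      (𝓝[>] 0) (𝓝 ‖Complex.Gamma (a + (0 : ℝ) + 2) * besselClifford (a + (0 : ℝ) + 3 / 2) r‖) :=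
    ((hcontG.mul hcontB.continuousAt).norm).tendsto.mono_left nhdsWithin_le_nhds
  have hlim2 : Tendsto (fun ε : ℝ => 10 * (T + ε)) (𝓝[>] 0) (𝓝 (10 * (T + 0))) :=
    ((by fun_prop : Continuous fun ε : ℝ => 10 * (T + ε)).tendsto 0).mono_left nhdsWithin_le_nhds
  have := le_of_tendsto_of_tendsto hlim hlim2 (by
    filter_upwards [self_mem_nhdsWithin] with ε hε
    have hε' : 0 < ε := hε
    have hn : ‖(ε : ℂ)‖ = ε := by rw [Complex.norm_real, Real.norm_of_nonneg hε'.le]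
    refine norm_Gamma_mul_besselClifford_le_of_lt (by simp; linarith) (by linarith) ?_ ?_ hr
    · exact (norm_add_le _ _).trans (by rw [hn]; linarith)
    · rw [add_right_comm]
      exact (norm_add_le _ _).trans (by rw [hn]; linarith))
  simpa using this

end Oscillatory

/-! ### Gamma function estimates and the interpolation weight -/

/-- Apply $\Gamma(b)\Gamma(\delta)=B(b,\delta)\Gamma(b+\delta)$; the absolute Beta integrand is
largest at $\Re b=x_0$. This compares Gamma functions along vertical lines without Stirling's
formula. -/
lemma exists_norm_Gamma_le_norm_Gamma_add {x₀ δ : ℝ} (hx₀ : 0 < x₀) (hδ : 0 ≤ δ) :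
    ∃ C : ℝ, 0 ≤ C ∧ ∀ b : ℂ, x₀ ≤ b.re → ‖Complex.Gamma b‖ ≤ C * ‖Complex.Gamma (b + δ)‖ := by
  rcases hδ.eq_or_lt with rfl | hδ
  · exact ⟨1, zero_le_one, fun b _ => by simp⟩
  have hconv := (Complex.betaIntegral_convergent (u := x₀) (v := δ) (by simpa) (by simpa)).norm
  have hΓ : 0 < ‖Complex.Gamma δ‖ := by
    rw [Complex.Gamma_ofReal, Complex.norm_real]
    exact norm_pos_iff.2 (Real.Gamma_pos_of_pos hδ).ne'
  set M : ℝ := ∫ x in (0 : ℝ)..1, ‖(x : ℂ) ^ ((x₀ : ℂ) - 1) * (1 - (x : ℂ)) ^ ((δ : ℂ) - 1)‖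
  have hM : 0 ≤ M := intervalIntegral.integral_nonneg zero_le_one fun x _ => norm_nonneg _
  refine ⟨M / ‖Complex.Gamma δ‖, by positivity, fun b hb => ?_⟩
  have hB : ‖Complex.betaIntegral b δ‖ ≤ M := by
    refine intervalIntegral.norm_integral_le_of_norm_le zero_le_one
      (Eventually.of_forall fun t ht => ?_) hconv
    rw [norm_mul, norm_mul]
    refine mul_le_mul_of_nonneg_right ?_ (norm_nonneg _)
    rw [Complex.norm_cpow_eq_rpow_re_of_pos ht.1, Complex.norm_cpow_eq_rpow_re_of_pos ht.1]
    exact Real.rpow_le_rpow_of_exponent_ge ht.1 ht.2 (by simpa using hb)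
  have h := Complex.Gamma_mul_Gamma_eq_betaIntegral (s := b) (t := δ) (hx₀.trans_le hb) (by simpa)
  have h' := congrArg norm h
  rw [norm_mul, norm_mul] at h'
  rw [div_mul_eq_mul_div, le_div_iff₀ hΓ, h', mul_comm]
  gcongr

/-- The number of poles removed from `Γ(z+1)` in `interpolationWeight`. -/
def poleCount (n : ℕ) : ℕ := (n + 1) / 2 + 1

/-- The weight `Γ(z+m+1) / (z+n+2)^m` of the analytic family of operators. -/
def interpolationWeight (n : ℕ) (z : ℂ) : ℂ :=
  Complex.Gamma (z + poleCount n + 1) / (z + (n + 2)) ^ poleCount n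

/-- The lower bound puts $z+m$ in $\Re\ge\frac12$ on the strip, away from the poles of $\Gamma$; the
upper one lets $\Gamma(z+m)$ be compared with $\Gamma(z+\frac{n+3}2)$, the factor in the Bessel
bound. -/
lemma poleCount_bounds (n : ℕ) :
    ((n : ℝ) + 1) / 2 + 1 / 2 ≤ poleCount n ∧ (poleCount n : ℝ) ≤ ((n : ℝ) + 3) / 2 := by
  have h1 : 2 * poleCount n ≤ n + 3 := by unfold poleCount; omega
  have h2 : n + 2 ≤ 2 * poleCount n := by unfold poleCount; omega
  have h1' : (2 : ℝ) * poleCount n ≤ n + 3 := by exact_mod_cast h1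
  have h2' : (n : ℝ) + 2 ≤ 2 * poleCount n := by exact_mod_cast h2
  constructor <;> linarith

lemma add_ne_zero_of_re_pos {z : ℂ} (h : 0 < z.re) : z ≠ 0 := fun h0 => by simp [h0] at h

lemma differentiableAt_interpolationWeight {n : ℕ} {z : ℂ} (hz : -(((n : ℝ) + 1) / 2) ≤ z.re) :
    DifferentiableAt ℂ (interpolationWeight n) z := by
  have hm := (poleCount_bounds n).1
  have h1 : 0 < (z + poleCount n + 1).re := by simp; linarith
  have h2 : 0 < (z + (n + 2)).re := by
    have : (0 : ℝ) ≤ n := n.cast_nonneg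
    simp; linarith
  refine DifferentiableAt.div ?_ (by fun_prop) (pow_ne_zero _ (add_ne_zero_of_re_pos h2))
  have hG : DifferentiableAt ℂ Complex.Gamma (z + poleCount n + 1) := by
    refine Complex.differentiableAt_Gamma _ fun m h => ?_
    rw [h] at h1
    simp at h1
    have : (0 : ℝ) ≤ m := m.cast_nonneg
    linarith
  exact DifferentiableAt.comp (f := fun z : ℂ => z + poleCount n + 1) z hG (by fun_prop)

lemma interpolationWeight_ne_zero {n : ℕ} {z : ℂ} (hz : -(((n : ℝ) + 1) / 2) ≤ z.re) :
    interpolationWeight n z ≠ 0 := by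
  have hm := (poleCount_bounds n).1
  have h1 : 0 < (z + poleCount n + 1).re := by simp; linarith
  have h2 : 0 < (z + (n + 2)).re := by
    have : (0 : ℝ) ≤ n := n.cast_nonneg
    simp; linarith
  exact div_ne_zero (Complex.Gamma_ne_zero_of_re_pos h1)
    (pow_ne_zero _ (add_ne_zero_of_re_pos h2))

/-- With $a=z+\frac{n-1}2$ the line $\Re z=-\frac{n+1}2$ becomes $\Re a=-1$. One linear factor comes
from $\Gamma(z+m+1)=(z+m)\Gamma(z+m)$, another from the Bessel bound; the denominator of the weight
pays for both because $m\ge2$ and $|z+n+2|\ge1$. -/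
lemma exists_norm_interpolationWeight_mul_besselClifford_le {n : ℕ} (hn : 1 ≤ n) :
    ∃ C : ℝ, 0 ≤ C ∧ ∀ z : ℂ, -(((n : ℝ) + 1) / 2) ≤ z.re → ∀ r : ℝ, 0 ≤ r →
      ‖interpolationWeight n z * besselClifford (z + n / 2 + 1) r‖ ≤ C := by
  obtain ⟨hm1, hm2⟩ := poleCount_bounds n
  have hmn : 2 ≤ poleCount n := by unfold poleCount; omega
  have hn' : (1 : ℝ) ≤ n := by exact_mod_cast hn
  obtain ⟨C, hC0, hC⟩ := exists_norm_Gamma_le_norm_Gamma_add (x₀ := 1 / 2)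
    (δ := ((n : ℝ) + 3) / 2 - poleCount n) (by norm_num) (by linarith)
  refine ⟨C * (10 * (2 * n + 5) * (2 * n + 5)), by positivity, fun z hz r hr => ?_⟩
  have hw : 1 ≤ ‖z + (n + 2)‖ := by
    refine le_trans ?_ (Complex.re_le_norm _)
    simp; linarith
  have hzw : ‖z‖ ≤ ‖z + (n + 2)‖ + (n + 2) := by
    have h := norm_sub_le (z + (n + 2)) (n + 2 : ℂ)
    have e : ‖(n + 2 : ℂ)‖ = n + 2 := by
      rw [show (n + 2 : ℂ) = ((n + 2 : ℕ) : ℂ) by push_cast; ring, Complex.norm_natCast]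
      push_cast; ring
    rwa [add_sub_cancel_right, e] at h
  set W : ℝ := ‖z + (n + 2)‖ with hW
  have hT : ‖Complex.Gamma ((z + (n - 1) / 2) + 2) *
      besselClifford ((z + (n - 1) / 2) + 3 / 2) r‖ ≤ 10 * (‖z‖ + n + 2) := by
    have e1 : ‖((n : ℂ) - 1) / 2‖ ≤ n := by
      rw [show ((n : ℂ) - 1) / 2 = (((n - 1) / 2 : ℝ) : ℂ) by push_cast; ring, Complex.norm_real,
        Real.norm_of_nonneg (by linarith)]
      linarith
    have hre : (((n : ℂ) - 1) / 2).re = (n - 1) / 2 := by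
      rw [show ((n : ℂ) - 1) / 2 = (((n - 1) / 2 : ℝ) : ℂ) by push_cast; ring, Complex.ofReal_re]
    have h1 : ‖z + (n - 1) / 2‖ ≤ ‖z‖ + n := (norm_add_le _ _).trans (by linarith)
    refine norm_Gamma_mul_besselClifford_le ?_ ?_ ?_ ?_ hr
    · rw [Complex.add_re, hre]; linarith
    · linarith [norm_nonneg z]
    · linarith
    · exact (norm_add_le _ _).trans (by rw [norm_one]; linarith)
  have hΓ : ‖Complex.Gamma (z + poleCount n)‖ ≤ C * ‖Complex.Gamma ((z + (n - 1) / 2) + 2)‖ := by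
    refine (hC (z + poleCount n) (by simp; linarith)).trans (le_of_eq ?_)
    congr 3
    push_cast; ring
  have hzm : 0 < (z + poleCount n).re := by simp; linarith
  have hzmn : ‖z + poleCount n‖ ≤ (2 * n + 5) * W := by
    refine (norm_add_le _ _).trans ?_
    rw [Complex.norm_natCast]
    nlinarith
  have hTn : ‖z‖ + n + 2 ≤ (2 * n + 5) * W := by nlinarith
  have hWpos : 0 < W := by linarith
  have earg : z + n / 2 + 1 = (z + (n - 1) / 2) + 3 / 2 := by ring
  rw [interpolationWeight, earg, Complex.Gamma_add_one _ (add_ne_zero_of_re_pos hzm), norm_mul,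
    norm_div, norm_mul, norm_pow, ← hW, div_mul_eq_mul_div, div_le_iff₀ (by positivity)]
  rw [norm_mul] at hT
  set E : ℝ := ‖besselClifford ((z + (n - 1) / 2) + 3 / 2) r‖
  calc ‖z + poleCount n‖ * ‖Complex.Gamma (z + poleCount n)‖ * E
      ≤ (2 * n + 5) * W * (C * ‖Complex.Gamma ((z + (n - 1) / 2) + 2)‖) * E := by gcongr
    _ = C * ((2 * n + 5) * W) * (‖Complex.Gamma ((z + (n - 1) / 2) + 2)‖ * E) := by ring
    _ ≤ C * ((2 * n + 5) * W) * (10 * ((2 * n + 5) * W)) := by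
        refine mul_le_mul_of_nonneg_left (hT.trans ?_) (by positivity)
        linarith
    _ = C * (10 * (2 * n + 5) * (2 * n + 5)) * W ^ 2 := by ring
    _ ≤ C * (10 * (2 * n + 5) * (2 * n + 5)) * W ^ poleCount n := by
        gcongr

/-- $\Gamma(z+m+1)$ is $\Gamma(z+1)$ times $m$ factors $z+j+1$, and on the imaginary axis each is
dominated by $z+n+2$ since $j+1\le n+2$. -/
lemma norm_interpolationWeight_le {n : ℕ} {z : ℂ} (hz : z.re = 0) :
    ‖interpolationWeight n z‖ ≤ ‖Complex.Gamma (z + 1)‖ := by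
  have hm : poleCount n ≤ n + 2 := by unfold poleCount; omega
  have h0 : 0 < ‖z + (n + 2)‖ := by
    refine norm_pos_iff.2 (add_ne_zero_of_re_pos ?_)
    simp [hz]; positivity
  have key : ∀ j : ℕ, j ≤ n + 2 →
      ‖Complex.Gamma (z + j + 1)‖ ≤ ‖Complex.Gamma (z + 1)‖ * ‖z + (n + 2)‖ ^ j := by
    intro j
    induction j with
    | zero => simp
    | succ j ih =>
      intro hj
      have hne : z + j + 1 ≠ 0 := add_ne_zero_of_re_pos (by simp [hz]; positivity)
      push_cast
      rw [← add_assoc, Complex.Gamma_add_one _ hne, norm_mul, pow_succ, ← mul_assoc, mul_comm]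
      have h1 : ‖z + j + 1‖ ≤ ‖z + (n + 2)‖ := by
        have hj' : (j : ℝ) + 1 ≤ n + 2 := by exact_mod_cast hj
        have hj0 : (0 : ℝ) ≤ j := j.cast_nonneg
        rw [Complex.norm_def, Complex.norm_def]
        refine Real.sqrt_le_sqrt ?_
        simp only [Complex.normSq_apply, Complex.add_re, Complex.add_im, Complex.natCast_re,
          Complex.natCast_im, Complex.one_re, Complex.one_im, hz, Complex.re_ofNat,
          Complex.im_ofNat]
        nlinarith
      exact mul_le_mul (ih (by omega)) h1 (norm_nonneg _) (by positivity)
  rw [interpolationWeight, norm_div, norm_pow, div_le_iff₀ (by positivity)]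
  exact key _ hm

lemma le_norm_of_le_abs_re {e : ℝ} (he : 0 ≤ e) {w : ℂ} (h : e ≤ |w.re|) :
    e / (1 + e) * (1 + |w.im|) ≤ ‖w‖ := by
  have h1 := h.trans (Complex.abs_re_le_norm w)
  have h2 := Complex.abs_im_le_norm w
  rw [div_mul_eq_mul_div, div_le_iff₀ (by positivity)]
  nlinarith

lemma bochnerRieszFactor_eq {z : ℂ} (hz : z + 1 ≠ 0) :
    bochnerRieszFactor z = Complex.Gamma (z + 3) / (z + 1) := by
  unfold bochnerRieszFactor
  split_ifs with h
  · subst h; norm_num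
  · have hz2 : z + 2 ≠ 0 := fun h' => h (eq_neg_of_add_eq_zero_left h')
    have e1 : Complex.Gamma (z + 3) = (z + 2) * Complex.Gamma (z + 2) := by
      rw [← Complex.Gamma_add_one _ hz2]; congr 1; ring
    have e2 : Complex.Gamma (z + 2) = (z + 1) * Complex.Gamma (z + 1) := by
      rw [← Complex.Gamma_add_one _ hz]; congr 1; ring
    rw [e1, e2]
    field_simp

lemma exists_norm_bochnerRieszFactor_le {n : ℕ} (hn : 1 ≤ n) {β : ℝ} (hβ₁ : 1 / 2 < β)
    (hβ₂ : β < 3 / 2) (hβ₃ : β ≤ ((n : ℝ) + 1) / 4) :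
    ∃ C : ℝ, 0 ≤ C ∧ ∀ μ : ℝ, ‖bochnerRieszFactor (-2 * (β : ℂ) + μ * Complex.I)‖ ≤
      C * (1 + |μ|) * ‖interpolationWeight n (-2 * (β : ℂ) + μ * Complex.I)‖ := by
  have hmn : 2 ≤ poleCount n := by unfold poleCount; omega
  -- The distance of $-2\beta$ from $-1$ and $-3$; this is where $\frac12<\beta<\frac32$ enters. It
  -- bounds $|w+1|$ and all $|w+3+j|$ below by $d(1+|\mu|)$.
  set e : ℝ := min (2 * β - 1) (3 - 2 * β) with he
  have he0 : 0 < e := lt_min (by linarith) (by linarith)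
  set d : ℝ := e / (1 + e) with hd
  have hd0 : 0 < d := by positivity
  set c : ℝ := 2 * β + n + 2 with hc
  have hn' : (1 : ℝ) ≤ n := by exact_mod_cast hn
  have hc0 : 1 ≤ c := by linarith
  refine ⟨c ^ poleCount n / (d * d ^ (poleCount n - 2)), by positivity, fun μ => ?_⟩
  set w : ℂ := -2 * (β : ℂ) + μ * Complex.I with hw
  have hwre : w.re = -2 * β := by simp [hw]
  have hwim : w.im = μ := by simp [hw]
  have h1 : d * (1 + |μ|) ≤ ‖w + 1‖ := by
    have := le_norm_of_le_abs_re he0.le (w := w + 1) (by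
      simp only [Complex.add_re, Complex.one_re, hwre]
      rw [abs_of_neg (by linarith)]
      exact (min_le_left _ _).trans (by linarith))
    simpa [hwim] using this
  have hj : ∀ j : ℕ, d * (1 + |μ|) ≤ ‖w + 3 + j‖ := fun j => by
    have hj0 : (0 : ℝ) ≤ j := j.cast_nonneg
    have := le_norm_of_le_abs_re he0.le (w := w + 3 + j) (by
      simp only [Complex.add_re, Complex.re_ofNat, Complex.natCast_re, hwre]
      rw [abs_of_pos (by linarith)]
      exact (min_le_right _ _).trans (by linarith))
    simpa [hwim] using this
  have hpos : 0 < d * (1 + |μ|) := by positivity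
  have key : ∀ j : ℕ, (d * (1 + |μ|)) ^ j * ‖Complex.Gamma (w + 3)‖ ≤
      ‖Complex.Gamma (w + 3 + j)‖ := by
    intro j
    induction j with
    | zero => simp
    | succ j ih =>
      have hne : w + 3 + j ≠ 0 := norm_pos_iff.1 (hpos.trans_le (hj j))
      push_cast
      rw [← add_assoc, Complex.Gamma_add_one _ hne, norm_mul, pow_succ', mul_assoc]
      exact mul_le_mul (hj j) ih (by positivity) (norm_nonneg _)
  have hcw : ‖w + (n + 2)‖ ≤ c * (1 + |μ|) := by
    have h2 : ‖w‖ ≤ 2 * β + |μ| := by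
      refine (norm_add_le _ _).trans (le_of_eq ?_)
      rw [norm_mul, norm_mul, norm_neg, Complex.norm_I, Complex.norm_real, Complex.norm_real,
        Real.norm_of_nonneg (by linarith)]
      simp
    have e : ‖(n + 2 : ℂ)‖ = n + 2 := by
      rw [show (n + 2 : ℂ) = ((n + 2 : ℕ) : ℂ) by push_cast; ring, Complex.norm_natCast]
      push_cast; ring
    refine (norm_add_le _ _).trans ?_
    rw [e]
    nlinarith [abs_nonneg μ]
  have hw1 : w + 1 ≠ 0 := norm_pos_iff.1 (hpos.trans_le h1)
  have hw2 : 0 < ‖w + (n + 2)‖ := by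
    refine norm_pos_iff.2 (add_ne_zero_of_re_pos ?_)
    simp [hwre]; linarith
  have hm : w + poleCount n + 1 = w + 3 + ((poleCount n - 2 : ℕ) : ℂ) := by
    rw [Nat.cast_sub hmn]; push_cast; ring
  have hk := key (poleCount n - 2)
  rw [bochnerRieszFactor_eq hw1, interpolationWeight, norm_div, norm_div, norm_pow, hm,
    div_le_iff₀ (hpos.trans_le h1)]
  set G : ℝ := ‖Complex.Gamma (w + 3)‖
  set X : ℝ := 1 + |μ| with hX
  have hX0 : 0 < X := by positivity
  -- Of the $m$ powers of $X$ in the denominator of the weight, $m-2$ are matched by the factors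
  -- between $\Gamma(w+3)$ and $\Gamma(w+m+1)$ and one by $|w+1|$; one power of $X$ remains.
  calc G = ((c * X) ^ poleCount n)⁻¹ * (c * X) ^ poleCount n * G := by
        rw [inv_mul_cancel₀ (by positivity), one_mul]
    _ = ((c * X) ^ poleCount n)⁻¹ * (c ^ poleCount n / (d * d ^ (poleCount n - 2)) * X *
          (d * X) * ((d * X) ^ (poleCount n - 2) * G)) := by
        have : (c * X) ^ poleCount n = c ^ poleCount n * (X * X * X ^ (poleCount n - 2)) := by
          rw [mul_pow, ← pow_two, ← pow_add, Nat.add_sub_cancel' hmn]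
        rw [mul_pow d X]
        rw [mul_assoc ((c * X) ^ poleCount n)⁻¹]
        congr 1
        rw [this]
        field_simp
    _ ≤ (‖w + (n + 2)‖ ^ poleCount n)⁻¹ * (c ^ poleCount n / (d * d ^ (poleCount n - 2)) * X *
          ‖w + 1‖ * ‖Complex.Gamma (w + 3 + ((poleCount n - 2 : ℕ) : ℂ))‖) := by
        gcongr
    _ = _ := by
        rw [div_eq_mul_inv ‖Complex.Gamma (w + 3 + ((poleCount n - 2 : ℕ) : ℂ))‖]
        ring

/-! ### Plancherel's theorem for the Fourier integral on L¹ ∩ L² -/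

section Plancherel

variable {V : Type*} [NormedAddCommGroup V] [InnerProductSpace ℝ V] [FiniteDimensional ℝ V]
  [MeasurableSpace V] [BorelSpace V]

lemma integral_fourier_mul_eq_of_integrable {f g : V → ℂ} (hf : Integrable f) (hg : Integrable g) :
    ∫ ξ, 𝓕 f ξ * g ξ = ∫ x, f x * 𝓕 g x := by
  simpa using! VectorFourier.integral_bilin_fourierIntegral_eq_flip (ContinuousLinearMap.mul ℂ ℂ)
    (L := innerₗ V) Real.continuous_fourierChar continuous_inner hf hg

lemma continuous_fourier_of_integrable {f : V → ℂ} (hf : Integrable f) : Continuous (𝓕 f) :=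
  VectorFourier.fourierIntegral_continuous Real.continuous_fourierChar
    (by exact continuous_inner) hf

lemma norm_fourier_le_integral_norm (f : V → ℂ) (w : V) : ‖𝓕 f w‖ ≤ ∫ v, ‖f v‖ :=
  VectorFourier.norm_fourierIntegral_le_integral_norm _ _ _ _ _

/-- On `L¹ ∩ L²` the Fourier integral represents the Fourier transform of `L²`. -/
lemma coeFn_fourier_toLp {f : V → ℂ} (hf : Integrable f) (hf2 : MemLp f 2) :
    (𝓕 (hf2.toLp f) : Lp ℂ 2 (volume : Measure V)) =ᵐ[volume] 𝓕 f := by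
  refine ae_eq_of_integral_contDiff_smul_eq
    ((Lp.memLp _).locallyIntegrable (by norm_num))
    (continuous_fourier_of_integrable hf).locallyIntegrable fun g hg hgs => ?_
  set φ : 𝓢(V, ℂ) := (hgs.comp_left (g := fun x : ℝ => (x : ℂ)) (by simp)).toSchwartzMap
    (Complex.ofRealCLM.contDiff.comp hg) with hφ
  have hφg : ∀ x, φ x = (g x : ℂ) := fun x => rfl
  -- Both transforms are tested against $\varphi$: the one of $L^2$ is dual to that of Schwartz
  -- functions by definition, the integral one by Fubini.
  have h := congrArg (fun T : 𝓢'(V, ℂ) => T φ) (Lp.fourier_toTemperedDistribution_eq (hf2.toLp f))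
  simp only [TemperedDistribution.fourier_apply, Lp.toTemperedDistribution_apply] at h
  calc ∫ x, g x • (𝓕 (hf2.toLp f) : Lp ℂ 2 (volume : Measure V)) x
      = ∫ x, φ x • (𝓕 (hf2.toLp f) : Lp ℂ 2 (volume : Measure V)) x := by
        simp_rw [hφg, Complex.real_smul, smul_eq_mul]
    _ = ∫ x, (𝓕 φ) x • (hf2.toLp f) x := h.symm
    _ = ∫ x, f x * 𝓕 (φ : V → ℂ) x := by
        refine integral_congr_ae ?_
        filter_upwards [hf2.coeFn_toLp] with x hx
        rw [hx, smul_eq_mul, mul_comm, SchwartzMap.fourier_coe]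
    _ = ∫ x, 𝓕 f x * φ x := (integral_fourier_mul_eq_of_integrable hf φ.integrable).symm
    _ = ∫ x, g x • 𝓕 f x := by
        simp_rw [hφg, Complex.real_smul, mul_comm]

/-- Plancherel's theorem on `L¹ ∩ L²`. -/
lemma eLpNorm_fourier_eq {f : V → ℂ} (hf : Integrable f) (hf2 : MemLp f 2) :
    eLpNorm (𝓕 f) 2 volume = eLpNorm f 2 volume := by
  rw [← eLpNorm_congr_ae (coeFn_fourier_toLp hf hf2), ← eLpNorm_congr_ae hf2.coeFn_toLp]
  have h := Lp.norm_fourier_eq (hf2.toLp f)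
  rw [Lp.norm_def, Lp.norm_def] at h
  exact (ENNReal.toReal_eq_toReal_iff' (Lp.eLpNorm_ne_top _) (Lp.eLpNorm_ne_top _)).1 h

lemma integrable_norm_sq_fourier {f : V → ℂ} (hf : Integrable f) (hf2 : MemLp f 2) :
    Integrable fun ξ => ‖𝓕 f ξ‖ ^ 2 := by
  have : MemLp (𝓕 f) 2 volume := (memLp_congr_ae (coeFn_fourier_toLp hf hf2)).1 (Lp.memLp _)
  exact this.integrable_norm_pow two_ne_zero

lemma integral_norm_sq_fourier {f : V → ℂ} (hf : Integrable f) (hf2 : MemLp f 2) :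
    ∫ ξ, ‖𝓕 f ξ‖ ^ 2 = ∫ x, ‖f x‖ ^ 2 := by
  have key : ∀ {h : V → ℂ}, MemLp h 2 volume →
      ∫ x, ‖h x‖ ^ 2 = (eLpNorm h 2 volume).toReal ^ 2 := fun {h} hh => by
    rw [hh.eLpNorm_eq_integral_rpow_norm (by norm_num) (by norm_num),
      ENNReal.toReal_ofReal (by positivity), ← Real.rpow_natCast, ← Real.rpow_mul (by positivity)]
    norm_num
  rw [key ((memLp_congr_ae (coeFn_fourier_toLp hf hf2)).1 (Lp.memLp _)), key hf2,
    eLpNorm_fourier_eq hf hf2]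

end Plancherel

/-! ### The convolution kernel and the L² endpoint -/

section Kernel

variable {V : Type*} [NormedAddCommGroup V] [InnerProductSpace ℝ V]

/-- The convolution kernel of `S̃ ^ z`. -/
def rieszKernel (z : ℂ) (x : V) : ℂ :=
  ((|((2 * Real.pi) ^ finrank ℝ V)⁻¹| : ℝ) : ℂ) * (Real.pi : ℂ) ^ (finrank ℝ V / 2 : ℂ) *
    besselClifford (z + finrank ℝ V / 2 + 1) ‖x‖

lemma continuous_rieszKernel : Continuous fun p : ℂ × V => rieszKernel p.1 p.2 := by
  have h : Continuous fun p : ℂ × V => (p.1 + (finrank ℝ V : ℂ) / 2 + 1, ‖p.2‖) :=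
    ((continuous_fst.add continuous_const).add continuous_const).prodMk continuous_snd.norm
  have h2 : Continuous fun p : ℂ × V => besselClifford (p.1 + (finrank ℝ V : ℂ) / 2 + 1) ‖p.2‖ :=
    (continuous_besselClifford.comp h :)
  exact h2.const_mul _

lemma differentiable_rieszKernel (x : V) : Differentiable ℂ fun z : ℂ => rieszKernel z x := by
  unfold rieszKernel
  exact ((differentiable_besselClifford ‖x‖).comp
    (show Differentiable ℂ fun z : ℂ => z + finrank ℝ V / 2 + 1 by fun_prop)).const_mul _

/-- The Bochner–Riesz symbol as a function of the frequency `ξ / 2π`. -/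
def rieszMultiplier (z : ℂ) (η : V) : ℂ := ballProfile z ‖(2 * Real.pi) • η‖

lemma norm_rieszMultiplier_le {z : ℂ} (hz : z.re = 0) (η : V) : ‖rieszMultiplier z η‖ ≤ 1 := by
  unfold rieszMultiplier ballProfile
  split_ifs with h
  · rw [Complex.norm_cpow_eq_rpow_re_of_pos, hz, Real.rpow_zero]
    nlinarith [norm_nonneg ((2 * Real.pi) • η)]
  · simp

variable [FiniteDimensional ℝ V] [MeasurableSpace V] [BorelSpace V] [Nontrivial V]

lemma integrable_rieszMultiplier {z : ℂ} (hz : -1 < z.re) :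
    Integrable (rieszMultiplier z : V → ℂ) :=
  (integrable_ballProfile hz).comp_smul (by positivity)

lemma fourierInv_rieszMultiplier {z : ℂ} (hz : -1 < z.re) (x : V) :
    𝓕⁻ (rieszMultiplier z : V → ℂ) x = Complex.Gamma (z + 1) * rieszKernel z x := by
  have h := Measure.integral_comp_smul (volume : Measure V) (fun ξ : V =>
    ballProfile z ‖ξ‖ * Complex.exp (Complex.I * ((inner ℝ x ξ : ℝ) : ℂ))) (2 * Real.pi)
  rw [integral_ballProfile_mul_exp hz] at h
  rw [Real.fourierInv_eq', rieszKernel]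
  calc _ = ∫ η : V, ballProfile z ‖(2 * Real.pi) • η‖ *
        Complex.exp (Complex.I * ((inner ℝ x ((2 * Real.pi) • η) : ℝ) : ℂ)) := by
        refine integral_congr_ae (Eventually.of_forall fun η => ?_)
        simp only [rieszMultiplier, smul_eq_mul]
        rw [real_inner_smul_right, real_inner_comm, mul_comm, mul_comm Complex.I]
    _ = _ := by
        rw [h, Complex.real_smul]
        ring

/-- The multiplication formula moves the transform from $f$ onto the modulated symbol, and
modulation becomes translation of the kernel to $x-y$. -/
lemma fourierInv_rieszMultiplier_mul_fourier {z : ℂ} (hz : -1 < z.re) {f : V → ℂ}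
    (hf : Integrable f) (x : V) :
    𝓕⁻ (fun η => rieszMultiplier z η * 𝓕 f η) x =
      Complex.Gamma (z + 1) * ∫ y, f y * rieszKernel z (x - y) := by
  have hg : Integrable (fun η : V => Complex.exp ((↑(2 * Real.pi * inner ℝ η x) * Complex.I)) *
      rieszMultiplier z η) := by
    refine (integrable_rieszMultiplier hz).bdd_mul (c := 1)
      (Continuous.aestronglyMeasurable (by fun_prop)) (Eventually.of_forall fun t => ?_)
    rw [Complex.norm_exp_ofReal_mul_I]
  have h := integral_fourier_mul_eq_of_integrable hf hg
  rw [Real.fourierInv_eq']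
  calc _ = ∫ ξ, 𝓕 f ξ * (Complex.exp ((↑(2 * Real.pi * inner ℝ ξ x) * Complex.I)) *
      rieszMultiplier z ξ) := by
        refine integral_congr_ae (Eventually.of_forall fun η => ?_)
        simp only [smul_eq_mul]
        ring
    _ = _ := by
        rw [h, ← integral_const_mul]
        refine integral_congr_ae (Eventually.of_forall fun y => ?_)
        simp only []
        rw [mul_left_comm, ← fourierInv_rieszMultiplier hz, Real.fourier_eq', Real.fourierInv_eq']
        congr 1
        refine integral_congr_ae (Eventually.of_forall fun η => ?_)
        simp only [smul_eq_mul]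
        rw [← mul_assoc, ← Complex.exp_add, inner_sub_right]
        congr 2
        push_cast
        ring

/-- The `L² → L²` bound of the operators `S ^ z` with purely imaginary `z`. -/
lemma norm_integral_mul_integral_rieszKernel_le {z : ℂ} (hz : z.re = 0) {f g : V → ℂ}
    (hf : Integrable f) (hf2 : MemLp f 2) (hg : Integrable g) (hg2 : MemLp g 2) :
    ‖Complex.Gamma (z + 1) * ∫ x, g x * ∫ y, f y * rieszKernel z (x - y)‖ ≤
      ((∫ x, ‖f x‖ ^ 2) + ∫ x, ‖g x‖ ^ 2) / 2 := by
  have hz1 : -1 < z.re := by rw [hz]; norm_num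
  have hσ : Integrable fun η : V => rieszMultiplier z η * 𝓕 f η :=
    (integrable_rieszMultiplier hz1).mul_bdd (c := ∫ v, ‖f v‖)
      (continuous_fourier_of_integrable hf).aestronglyMeasurable
      (Eventually.of_forall fun η => norm_fourier_le_integral_norm f η)
  -- The pairing is bilinear, without conjugation, hence the reflection $\xi\mapsto-\xi$.
  have e1 : Complex.Gamma (z + 1) * ∫ x, g x * ∫ y, f y * rieszKernel z (x - y) =
      ∫ ξ, 𝓕 g ξ * (rieszMultiplier z (-ξ) * 𝓕 f (-ξ)) := by
    rw [integral_fourier_mul_eq_of_integrable hg hσ.comp_neg, ← integral_const_mul,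
      ← Real.fourierInv_eq_fourier_comp_neg (fun η => rieszMultiplier z η * 𝓕 f η)]
    refine integral_congr_ae (Eventually.of_forall fun x => ?_)
    simp only []
    rw [fourierInv_rieszMultiplier_mul_fourier hz1 hf]
    ring
  rw [e1]
  have hF := (integrable_norm_sq_fourier hf hf2).comp_neg
  have hG := integrable_norm_sq_fourier hg hg2
  -- The inequality $2ab\le a^2+b^2$ replaces Cauchy–Schwarz; nothing is lost for normalised
  -- functions.
  calc _ ≤ ∫ ξ, (‖𝓕 f (-ξ)‖ ^ 2 + ‖𝓕 g ξ‖ ^ 2) / 2 := by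
        refine norm_integral_le_of_norm_le ((hF.add hG).div_const 2)
          (Eventually.of_forall fun ξ => ?_)
        rw [norm_mul, norm_mul]
        have h1 := norm_rieszMultiplier_le hz (-ξ)
        have h2 : ‖rieszMultiplier z (-ξ)‖ * ‖𝓕 f (-ξ)‖ ≤ ‖𝓕 f (-ξ)‖ :=
          mul_le_of_le_one_left (norm_nonneg _) h1
        nlinarith [norm_nonneg (𝓕 g ξ), sq_nonneg (‖𝓕 f (-ξ)‖ - ‖𝓕 g ξ‖)]
    _ = _ := by
        rw [integral_div, integral_add hF hG, integral_neg_eq_self (fun ξ => ‖𝓕 f ξ‖ ^ 2) volume,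
          integral_norm_sq_fourier hf hf2, integral_norm_sq_fourier hg hg2]

end Kernel

/-! ### Holomorphic dependence of integrals on a parameter -/

section Parametric

/-- Holomorphy of an integral depending on a parameter. -/
lemma differentiableOn_integral_of_norm_le {α : Type*} [MeasurableSpace α] {μ : Measure α}
    {U : Set ℂ} {Φ : ℂ → α → ℂ} {bound : α → ℝ} (hU : IsOpen U)
    (hm : ∀ z ∈ U, AEStronglyMeasurable (Φ z) μ) (hd : ∀ a, DifferentiableOn ℂ (fun z => Φ z a) U)
    (hb : ∀ z ∈ U, ∀ a, ‖Φ z a‖ ≤ bound a) (hi : Integrable bound μ) :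
    DifferentiableOn ℂ (fun z => ∫ a, Φ z a ∂μ) U := by
  intro z₀ hz₀
  obtain ⟨ε, hε, hball⟩ := Metric.isOpen_iff.1 hU z₀ hz₀
  have hε2 : 0 < ε / 2 := by positivity
  have hsub : ∀ z ∈ Metric.ball z₀ (ε / 2), Metric.closedBall z (ε / 4) ⊆ U := fun z hz w hw => by
    refine hball ?_
    rw [Metric.mem_ball] at hz ⊢
    rw [Metric.mem_closedBall] at hw
    linarith [dist_triangle w z z₀]
  have hdiff : ∀ a, ∀ z ∈ Metric.ball z₀ (ε / 2),
      HasDerivAt (fun z => Φ z a) (deriv (fun z => Φ z a) z) z := fun a z hz =>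
    ((hd a).differentiableAt (hU.mem_nhds (hsub z hz
      (Metric.mem_closedBall_self (by positivity))))).hasDerivAt
  have hz₀' : z₀ ∈ Metric.ball z₀ (ε / 2) := Metric.mem_ball_self hε2
  set u : ℕ → ℂ := fun k => z₀ + ((ε / 2 / (k + 2) : ℝ) : ℂ) with hu
  have hupos : ∀ k : ℕ, 0 < ε / 2 / ((k : ℝ) + 2) := fun k => by positivity
  have huU : ∀ k, u k ∈ U := fun k => by
    refine hball ?_
    rw [Metric.mem_ball, dist_eq_norm, hu, add_sub_cancel_left, Complex.norm_real,
      Real.norm_of_nonneg (hupos k).le, div_lt_iff₀ (by positivity)]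
    have : (0 : ℝ) ≤ k := k.cast_nonneg
    nlinarith
  have hulim : Tendsto u atTop (𝓝[≠] z₀) := by
    refine tendsto_nhdsWithin_iff.2 ⟨?_, Eventually.of_forall fun k => ?_⟩
    · have h1 : Tendsto (fun k : ℕ => ε / 2 / ((k : ℝ) + 2)) atTop (𝓝 0) :=
        tendsto_const_nhds.div_atTop
          (tendsto_atTop_add_const_right _ _ tendsto_natCast_atTop_atTop)
      have h2 := (Complex.continuous_ofReal.tendsto 0).comp h1
      simpa [hu] using h2.const_add z₀
    · simpa [hu] using (by exact_mod_cast (hupos k).ne' :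
        ((ε / 2 / ((k : ℝ) + 2) : ℝ) : ℂ) ≠ 0)
  -- The derivative is a pointwise limit of difference quotients along a sequence tending to $z_0$.
  have hmeas : AEStronglyMeasurable (fun a => deriv (fun z => Φ z a) z₀) μ := by
    refine aestronglyMeasurable_of_tendsto_ae atTop
      (f := fun k a => slope (fun z => Φ z a) z₀ (u k)) (fun k => ?_)
      (Eventually.of_forall fun a => (hdiff a z₀ hz₀').tendsto_slope.comp hulim)
    simp only [slope_def_field, div_eq_mul_inv]
    exact AEStronglyMeasurable.mul_const ((hm _ (huU k)).sub (hm _ hz₀)) _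
  refine (hasDerivAt_integral_of_dominated_loc_of_deriv_le (bound := fun a => bound a / (ε / 4))
    (F' := fun z a => deriv (fun z => Φ z a) z) (Metric.ball_mem_nhds z₀ hε2)
    (by filter_upwards [hU.mem_nhds hz₀] with z hz using hm z hz)
    (hi.mono' (hm z₀ hz₀) (Eventually.of_forall (hb z₀ hz₀))) hmeas
    (Eventually.of_forall fun a z hz => ?_) (hi.div_const _)
    (Eventually.of_forall hdiff)).2.differentiableAt.differentiableWithinAt
  -- Cauchy's estimate on a disc of radius $\varepsilon/4$ inside $U$ dominates the derivative by
  -- the bound on the functions themselves.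
  refine Complex.norm_deriv_le_of_forall_mem_sphere_norm_le (by positivity) ?_
    fun w hw => hb w (hsub z hz (Metric.sphere_subset_closedBall hw)) a
  refine DifferentiableOn.diffContOnCl ((hd a).mono ?_)
  rw [closure_ball _ (by positivity)]
  exact hsub z hz

end Parametric

/-! ### The analytic continuation as a convolution -/

section Continuation

variable {V : Type*} [NormedAddCommGroup V] [InnerProductSpace ℝ V] [FiniteDimensional ℝ V]

/-- Only $y$ in the support of $f$ matter, so $(z,x-y)$ stays in a compact set, where the jointly
continuous kernel is bounded. No decay of the kernel is needed. -/
lemma exists_norm_mul_rieszKernel_le {f : V → ℂ} (hfs : HasCompactSupport f) (R R' : ℝ) :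
    ∃ M : ℝ, ∀ z : ℂ, ‖z‖ ≤ R → ∀ x : V, ‖x‖ ≤ R' → ∀ y,
      ‖f y * rieszKernel z (x - y)‖ ≤ M * ‖f y‖ := by
  obtain ⟨M, hM⟩ := (((isCompact_closedBall (0 : ℂ) R).prod
    ((isCompact_closedBall (0 : V) R').prod hfs)).image
      (show Continuous fun p : ℂ × V × V => (p.1, p.2.1 - p.2.2) by
        fun_prop)).exists_bound_of_continuousOn
    (continuous_rieszKernel (V := V)).continuousOn
  refine ⟨M, fun z hz x hx y => ?_⟩
  by_cases hy : f y = 0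
  · simp [hy]
  · rw [norm_mul, mul_comm]
    refine mul_le_mul_of_nonneg_right (hM (z, x - y) ⟨(z, x, y), ⟨?_, ?_, ?_⟩, rfl⟩) (norm_nonneg _)
    · simpa using hz
    · simpa using hx
    · exact subset_tsupport f hy

variable [MeasurableSpace V] [BorelSpace V]

/-- The operator `S̃ ^ z` on integrable functions of compact support. -/
def rieszPotential (z : ℂ) (f : V → ℂ) (x : V) : ℂ := ∫ y, f y * rieszKernel z (x - y)

lemma aestronglyMeasurable_mul_rieszKernel {f : V → ℂ} (hf : AEStronglyMeasurable f volume) (z : ℂ)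
    (x : V) : AEStronglyMeasurable (fun y => f y * rieszKernel z (x - y)) volume :=
  hf.mul ((continuous_rieszKernel.comp
    (show Continuous fun y : V => (z, x - y) by fun_prop)).aestronglyMeasurable :)

lemma differentiable_rieszPotential {f : V → ℂ} (hf : Integrable f) (hfs : HasCompactSupport f)
    (x : V) : Differentiable ℂ fun z => rieszPotential z f x := by
  intro z₀
  obtain ⟨M, hM⟩ := exists_norm_mul_rieszKernel_le hfs (‖z₀‖ + 1) ‖x‖
  refine (differentiableOn_integral_of_norm_le (U := Metric.ball 0 (‖z₀‖ + 1))
    (bound := fun y => M * ‖f y‖) Metric.isOpen_ball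
    (fun z _ => aestronglyMeasurable_mul_rieszKernel hf.1 z x)
    (fun y => ((differentiable_rieszKernel (x - y)).const_mul (f y)).differentiableOn)
    (fun z hz y => hM z (mem_ball_zero_iff.1 hz).le x le_rfl y)
    (hf.norm.const_mul M)).differentiableAt (Metric.isOpen_ball.mem_nhds ?_)
  rw [mem_ball_zero_iff]
  exact lt_add_one _

lemma continuous_rieszPotential {f : V → ℂ} (hf : Integrable f) (hfs : HasCompactSupport f)
    (z : ℂ) : Continuous (rieszPotential z f) := by
  rw [continuous_iff_continuousAt]
  intro x₀
  obtain ⟨M, hM⟩ := exists_norm_mul_rieszKernel_le hfs ‖z‖ (‖x₀‖ + 1)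
  refine continuousAt_of_dominated (bound := fun y => M * ‖f y‖)
    (Eventually.of_forall fun x => aestronglyMeasurable_mul_rieszKernel hf.1 z x) ?_
    (hf.norm.const_mul M) (Eventually.of_forall fun y => ?_)
  · have : Metric.ball (0 : V) (‖x₀‖ + 1) ∈ 𝓝 x₀ := by
      refine Metric.isOpen_ball.mem_nhds ?_
      rw [mem_ball_zero_iff]
      exact lt_add_one _
    filter_upwards [this] with x hx
    exact Eventually.of_forall fun y => hM z le_rfl x (mem_ball_zero_iff.1 hx).le y
  · refine Continuous.continuousAt (continuous_const.mul ?_)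
    exact (continuous_rieszKernel.comp (show Continuous fun x : V => (z, x - y) by fun_prop) :)

end Continuation

lemma bochnerRieszSymbol_eq_rieszMultiplier {n : ℕ} (s : ℝ) (η : EuclideanSpace ℝ (Fin n)) :
    (bochnerRieszSymbol s ((2 * Real.pi) • η) : ℂ) = rieszMultiplier s η := by
  unfold bochnerRieszSymbol rieszMultiplier ballProfile
  by_cases h : ‖(2 * Real.pi) • η‖ < 1
  · rw [Set.indicator_of_mem (mem_ball_zero_iff.2 h), if_pos h, Complex.ofReal_cpow]
    nlinarith [norm_nonneg ((2 * Real.pi) • η)]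
  · rw [Set.indicator_of_notMem (fun h' => h (mem_ball_zero_iff.1 h')), if_neg h,
      Complex.ofReal_zero]

lemma isBochnerRieszContinuation_rieszPotential {n : ℕ} (hn : 1 ≤ n)
    {f : EuclideanSpace ℝ (Fin n) → ℂ} (hf : Integrable f) (hfs : HasCompactSupport f)
    (x : EuclideanSpace ℝ (Fin n)) :
    IsBochnerRieszContinuation f x fun z => rieszPotential z f x := by
  have : NeZero n := ⟨by omega⟩
  refine ⟨differentiable_rieszPotential hf hfs x, fun s hs => ?_⟩
  have hΓ : Complex.Gamma ((s : ℂ) + 1) ≠ 0 :=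
    Complex.Gamma_ne_zero_of_re_pos (by simp; linarith)
  simp only [bochnerRiesz, bochnerRieszSymbol_eq_rieszMultiplier]
  rw [fourierInv_rieszMultiplier_mul_fourier (by simpa using hs) hf, ← mul_assoc,
    inv_mul_cancel₀ hΓ, one_mul]
  rfl

lemma isAnalyticBochnerRiesz_rieszPotential {n : ℕ} (hn : 1 ≤ n)
    {f : EuclideanSpace ℝ (Fin n) → ℂ} (hf : Integrable f) (hfs : HasCompactSupport f) (z : ℂ) :
    IsAnalyticBochnerRiesz z f (rieszPotential z f) := fun x =>
  ⟨_, isBochnerRieszContinuation_rieszPotential hn hf hfs x, rfl⟩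

/-! ### Complex powers of the test functions -/

section PhasePower

variable {α : Type*}

/-- The function `f |f| ^ (l - 1)`. -/
def phasePower (l : ℂ) (f : α → ℂ) (x : α) : ℂ := f x * (‖f x‖ : ℂ) ^ (l - 1)

lemma norm_phasePower {l : ℂ} (hl : 0 < l.re) (f : α → ℂ) (x : α) :
    ‖phasePower l f x‖ = ‖f x‖ ^ l.re := by
  unfold phasePower
  rcases (norm_nonneg (f x)).eq_or_lt with h | h
  · rw [norm_mul, ← h, zero_mul, Real.zero_rpow hl.ne']
  · rw [norm_mul, Complex.norm_cpow_eq_rpow_re_of_pos h, Complex.sub_re, Complex.one_re,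
      Real.rpow_sub_one h.ne']
    field_simp

lemma phasePower_one (f : α → ℂ) : phasePower 1 f = f := by
  ext x; simp [phasePower]

lemma differentiable_phasePower {l : ℂ → ℂ} (hl : Differentiable ℂ l) (f : α → ℂ) (x : α) :
    Differentiable ℂ fun z => phasePower (l z) f x := by
  unfold phasePower
  by_cases h : f x = 0
  · simp [h]
  · exact Differentiable.const_mul (fun z => DifferentiableAt.const_cpow
      ((hl z).sub_const 1) (Or.inl (by simpa using h))) _

variable [TopologicalSpace α]

/-- A bound for all the powers `|f| ^ r`, `0 < r ≤ p`. -/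
def powerBound (p : ℝ) (f : α → ℂ) (x : α) : ℝ :=
  (tsupport f).indicator (fun _ => (1 : ℝ)) x + ‖f x‖ ^ p

/-- Where $|f|\le1$ the power is at most $1$ on the support, elsewhere at most $|f|^p$. For
compactly supported $f$ this one integrable majorant serves the whole strip, so simple functions are
not needed. -/
lemma norm_phasePower_le {p : ℝ} {l : ℂ} (hl : 0 < l.re) (hlp : l.re ≤ p) (f : α → ℂ) (x : α) :
    ‖phasePower l f x‖ ≤ powerBound p f x := by
  rw [norm_phasePower hl, powerBound]
  by_cases h : f x = 0
  · rw [h, norm_zero, Real.zero_rpow hl.ne', Real.zero_rpow (hl.trans_le hlp).ne', add_zero]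
    exact Set.indicator_nonneg (fun _ _ => zero_le_one) _
  · rw [Set.indicator_of_mem (subset_tsupport f h)]
    rcases le_total ‖f x‖ 1 with h1 | h1
    · linarith [Real.rpow_le_one (norm_nonneg (f x)) h1 hl.le,
        Real.rpow_nonneg (norm_nonneg (f x)) p]
    · linarith [Real.rpow_le_rpow_of_exponent_le h1 hlp]

end PhasePower

/-- The uniform bound of the weighted kernel in the strip of interpolation. -/
lemma exists_norm_interpolationWeight_mul_rieszKernel_le (V : Type*) [NormedAddCommGroup V]
    [InnerProductSpace ℝ V] [FiniteDimensional ℝ V] [Nontrivial V] :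
    ∃ C : ℝ, 0 ≤ C ∧ ∀ z : ℂ, -(((finrank ℝ V : ℝ) + 1) / 2) ≤ z.re → ∀ x : V,
      ‖interpolationWeight (finrank ℝ V) z * rieszKernel z x‖ ≤ C := by
  obtain ⟨C, hC0, hC⟩ := exists_norm_interpolationWeight_mul_besselClifford_le
    (Module.finrank_pos (R := ℝ) (M := V))
  refine ⟨‖((|((2 * Real.pi) ^ finrank ℝ V)⁻¹| : ℝ) : ℂ) *
    (Real.pi : ℂ) ^ (finrank ℝ V / 2 : ℂ)‖ * C, by positivity, fun z hz x => ?_⟩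
  rw [rieszKernel, mul_left_comm, norm_mul]
  exact mul_le_mul_of_nonneg_left (hC z hz _ (norm_nonneg x)) (norm_nonneg _)

/-! ### Stein interpolation for normalised functions -/

section Interpolation

variable {V : Type*} [NormedAddCommGroup V] [InnerProductSpace ℝ V] [FiniteDimensional ℝ V]
  [MeasurableSpace V] [BorelSpace V]

lemma aestronglyMeasurable_phasePower {f : V → ℂ} (hf : AEStronglyMeasurable f volume) (l : ℂ) :
    AEStronglyMeasurable (phasePower l f) volume :=
  (hf.aemeasurable.mul
    ((Complex.measurable_ofReal.comp_aemeasurable hf.norm.aemeasurable).pow_const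
      (l - 1))).aestronglyMeasurable

lemma integrable_powerBound {p : ℝ} {f : V → ℂ} (hfs : HasCompactSupport f)
    (hf : Integrable fun x => ‖f x‖ ^ p) : Integrable (powerBound p f) := by
  refine Integrable.add ?_ hf
  rw [integrable_indicator_iff (isClosed_tsupport f).measurableSet]
  exact integrableOn_const hfs.measure_lt_top.ne

variable [Nontrivial V]

/-- Interpolation of the analytic family `S̃ ^ z` between the lines `Re z = 0` and
`Re z = -(n+1)/2`, for normalised functions. -/
lemma norm_interpolationWeight_mul_integral_le_of_integral_eq_one {C : ℝ} (hC0 : 0 ≤ C)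
    (hC : ∀ z : ℂ, -(((finrank ℝ V : ℝ) + 1) / 2) ≤ z.re → ∀ x : V,
      ‖interpolationWeight (finrank ℝ V) z * rieszKernel z x‖ ≤ C)
    {w : ℂ} (hw : -(((finrank ℝ V : ℝ) + 1) / 2) ≤ w.re) (hw0 : w.re ≤ 0) {p : ℝ} (hp0 : 0 < p)
    (hp : p / 2 * (1 - 2 * w.re / (finrank ℝ V + 1)) = 1) {f g : V → ℂ}
    (hfm : AEStronglyMeasurable f volume) (hfs : HasCompactSupport f)
    (hfi : Integrable fun x => ‖f x‖ ^ p) (hf1 : ∫ x, ‖f x‖ ^ p = 1)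
    (hgm : AEStronglyMeasurable g volume) (hgs : HasCompactSupport g)
    (hgi : Integrable fun x => ‖g x‖ ^ p) (hg1 : ∫ x, ‖g x‖ ^ p = 1) :
    ‖interpolationWeight (finrank ℝ V) w * ∫ x, g x * rieszPotential w f x‖ ≤ max C 1 := by
  set n : ℝ := (finrank ℝ V : ℝ) with hn
  have hn0 : 0 ≤ n := Nat.cast_nonneg _
  set H := interpolationWeight (finrank ℝ V)
  set σ : ℝ := -((n + 1) / 2) with hσ
  have hσ0 : σ < 0 := by rw [hσ]; linarith
  -- An affine exponent with real part $p$ on $\Re z=\sigma$, $p/2$ on $\Re z=0$, and $l(w)=1$. Thus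
  -- the powers of $f$ and $g$ are normalised in $L^1$, respectively $L^2$, on the two lines and are
  -- $f$ and $g$ themselves at $w$.
  set l : ℂ → ℂ := fun z => p / 2 * (1 - 2 * (z - w.im * Complex.I) / (n + 1)) with hl
  have hlre : ∀ z, (l z).re = p / 2 * (1 - 2 * z.re / (n + 1)) := fun z => by
    have : l z = ((p / 2 : ℝ) : ℂ) * (1 - ((2 / (n + 1) : ℝ) : ℂ) * (z - w.im * Complex.I)) := by
      rw [hl]; push_cast; ring
    rw [this, Complex.re_ofReal_mul, Complex.sub_re, Complex.re_ofReal_mul,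
      show (z - w.im * Complex.I).re = z.re by simp, Complex.one_re]
    ring
  have hlw : l w = 1 := by
    have e : w - w.im * Complex.I = w.re := by
      rw [sub_eq_iff_eq_add]; exact (Complex.re_add_im w).symm
    rw [hl]
    simp only [e]
    exact_mod_cast hp
  have hldiff : Differentiable ℂ l := by rw [hl]; fun_prop
  have hlpos : ∀ z : ℂ, σ ≤ z.re → z.re ≤ 0 → p / 2 ≤ (l z).re ∧ (l z).re ≤ p := by
    intro z h1 h2
    rw [hlre]
    have h3 : 0 ≤ -(2 * z.re / (n + 1)) := by
      rw [← neg_div]; exact div_nonneg (by linarith) (by linarith)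
    have h4 : -(2 * z.re / (n + 1)) ≤ 1 := by
      rw [← neg_div, div_le_one (by linarith)]; rw [hσ] at h1; linarith
    constructor <;> nlinarith
  set Φ : ℂ → V × V → ℂ := fun z q => H z * rieszKernel z (q.1 - q.2) *
    (phasePower (l z) g q.1 * phasePower (l z) f q.2) with hΦ
  set B : V × V → ℝ := fun q => C * (powerBound p g q.1 * powerBound p f q.2) with hB
  have hBi : Integrable B (volume.prod volume) :=
    ((integrable_powerBound hgs hgi).mul_prod (integrable_powerBound hfs hfi)).const_mul C
  have hΦm : ∀ z, AEStronglyMeasurable (Φ z) (volume.prod volume) := fun z => by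
    have h1 : Continuous fun q : V × V => rieszKernel z (q.1 - q.2) :=
      (continuous_rieszKernel.comp (show Continuous fun q : V × V => (z, q.1 - q.2) by fun_prop) :)
    refine (h1.aestronglyMeasurable.const_mul (H z)).mul ?_
    exact (aestronglyMeasurable_phasePower hgm (l z)).comp_fst.mul
      (aestronglyMeasurable_phasePower hfm (l z)).comp_snd
  have hΦb : ∀ z : ℂ, σ ≤ z.re → z.re ≤ 0 → ∀ q, ‖Φ z q‖ ≤ B q := by
    intro z h1 h2 q
    have h3 := hlpos z h1 h2
    have h4 : 0 < (l z).re := by linarith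
    rw [hΦ, hB]
    simp only []
    rw [norm_mul, norm_mul (phasePower _ _ _)]
    gcongr
    · exact hC z h1 _
    · exact (norm_nonneg _).trans (norm_phasePower_le h4 h3.2 g q.1)
    · exact norm_phasePower_le h4 h3.2 g q.1
    · exact norm_phasePower_le h4 h3.2 f q.2
  have hΦd : ∀ q, ∀ z : ℂ, σ ≤ z.re → DifferentiableAt ℂ (fun z => Φ z q) z := fun q z hz =>
    ((differentiableAt_interpolationWeight hz).mul (differentiable_rieszKernel _ z)).mul
      ((differentiable_phasePower hldiff g q.1 z).mul (differentiable_phasePower hldiff f q.2 z))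
  set F : ℂ → ℂ := fun z => ∫ q, Φ z q ∂(volume.prod volume) with hF
  have hFeq : ∀ z : ℂ, σ ≤ z.re → z.re ≤ 0 → F z = H z * ∫ x, phasePower (l z) g x *
      ∫ y, phasePower (l z) f y * rieszKernel z (x - y) := by
    intro z h1 h2
    rw [hF]
    simp only []
    rw [integral_prod _ (hBi.mono' (hΦm z) (Eventually.of_forall (hΦb z h1 h2))),
      ← integral_const_mul]
    refine integral_congr_ae (Eventually.of_forall fun x => ?_)
    simp only []
    rw [← integral_const_mul, ← integral_const_mul]
    refine integral_congr_ae (Eventually.of_forall fun y => ?_)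
    simp only [hΦ]
    ring
  have hclos : closure (Complex.re ⁻¹' Set.Ioo σ 0) ⊆ Complex.re ⁻¹' Set.Icc σ 0 :=
    closure_minimal (Set.preimage_mono Set.Ioo_subset_Icc_self)
      (isClosed_Icc.preimage Complex.continuous_re)
  have hdcc : DiffContOnCl ℂ F (Complex.re ⁻¹' Set.Ioo σ 0) := by
    refine ⟨differentiableOn_integral_of_norm_le (isOpen_Ioo.preimage Complex.continuous_re)
      (fun z _ => hΦm z) (fun q z hz => (hΦd q z hz.1.le).differentiableWithinAt)
      (fun z hz => hΦb z hz.1.le hz.2.le) hBi, ContinuousOn.mono ?_ hclos⟩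
    exact continuousOn_of_dominated (bound := B) (fun z _ => hΦm z)
      (fun z hz => Eventually.of_forall (hΦb z hz.1 hz.2)) hBi
      (Eventually.of_forall fun q z hz => (hΦd q z hz.1).continuousAt.continuousWithinAt)
  have hFb : ∀ z : ℂ, σ ≤ z.re → z.re ≤ 0 → ‖F z‖ ≤ ∫ q, B q ∂(volume.prod volume) :=
    fun z h1 h2 => norm_integral_le_of_norm_le hBi (Eventually.of_forall (hΦb z h1 h2))
  have hmain : ‖F w‖ ≤ max C 1 := by
    -- `F` is bounded on the strip by the integral of `B`, so the growth condition holds with zero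
    -- constants.
    refine PhragmenLindelof.vertical_strip hdcc ⟨0, div_pos Real.pi_pos (by linarith), 0, ?_⟩
      (fun z hz => ?_) (fun z hz => ?_) hw hw0
    · simp only [zero_mul, Real.exp_zero]
      refine Asymptotics.IsBigO.of_bound (∫ q, B q ∂(volume.prod volume)) ?_
      refine eventually_inf_principal.2 (Eventually.of_forall fun z hz => ?_)
      rw [norm_one, mul_one]
      exact hFb z hz.1.le hz.2.le
    · refine le_trans ?_ (le_max_left C 1)
      have hre : (l z).re = p := by
        rw [hlre, hz, hσ]
        have : n + 1 ≠ 0 := by linarith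
        field_simp
        ring
      have hpos : 0 < (l z).re := by rw [hre]; exact hp0
      calc ‖F z‖ ≤ ∫ q : V × V, C * (‖g q.1‖ ^ p * ‖f q.2‖ ^ p) ∂(volume.prod volume) := by
            refine norm_integral_le_of_norm_le ((hgi.mul_prod hfi).const_mul C)
              (Eventually.of_forall fun q => ?_)
            rw [hΦ]
            simp only []
            rw [norm_mul, norm_mul (phasePower _ _ _), norm_phasePower hpos, norm_phasePower hpos,
              hre]
            exact mul_le_mul_of_nonneg_right (hC z hz.ge _) (by positivity)
        _ = C := by
            rw [integral_const_mul, integral_prod_mul (fun x => ‖g x‖ ^ p) (fun x => ‖f x‖ ^ p),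
              hf1, hg1, mul_one, mul_one]
    · refine le_trans ?_ (le_max_right C 1)
      have hre : (l z).re = p / 2 := by rw [hlre, hz]; ring
      have hz1 := hlpos z (by rw [hz]; exact hσ0.le) hz.le
      have hpos : 0 < (l z).re := by linarith
      have hsq : ∀ h : V → ℂ, (fun x => ‖phasePower (l z) h x‖ ^ 2) = fun x => ‖h x‖ ^ p := by
        intro h
        ext x
        rw [norm_phasePower hpos, hre, ← Real.rpow_natCast, ← Real.rpow_mul (norm_nonneg _)]
        congr 1
        push_cast; ring
      have hint : ∀ {h : V → ℂ}, AEStronglyMeasurable h volume → HasCompactSupport h →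
          (Integrable fun x => ‖h x‖ ^ p) → Integrable (phasePower (l z) h) := fun hm hs hi =>
        (integrable_powerBound hs hi).mono' (aestronglyMeasurable_phasePower hm _)
          (Eventually.of_forall (norm_phasePower_le hpos hz1.2 _))
      have hL2 : ∀ {h : V → ℂ}, AEStronglyMeasurable h volume →
          (Integrable fun x => ‖h x‖ ^ p) → MemLp (phasePower (l z) h) 2 := fun hm hi => by
        rw [memLp_two_iff_integrable_sq_norm (aestronglyMeasurable_phasePower hm _), hsq]
        exact hi
      rw [hFeq z (by rw [hz]; exact hσ0.le) hz.le, norm_mul]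
      refine (mul_le_mul_of_nonneg_right (norm_interpolationWeight_le hz) (norm_nonneg _)).trans ?_
      rw [← norm_mul]
      refine (norm_integral_mul_integral_rieszKernel_le hz (hint hfm hfs hfi) (hL2 hfm hfi)
        (hint hgm hgs hgi) (hL2 hgm hgi)).trans ?_
      rw [hsq, hsq, hf1, hg1]
      norm_num
  rw [hFeq w hw hw0, hlw, phasePower_one, phasePower_one] at hmain
  exact hmain

end Interpolation

/-! ### Duality for the target norm -/

section Duality

variable {V : Type*} [NormedAddCommGroup V] [InnerProductSpace ℝ V] [FiniteDimensional ℝ V]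
  [MeasurableSpace V] [BorelSpace V]

/-- The function dual to `v` in the ball of radius `R`. -/
def dualFunction (q R : ℝ) (v : V → ℂ) : V → ℂ :=
  (Metric.closedBall (0 : V) R).indicator
    fun x => (starRingEnd ℂ) (v x) * ((‖v x‖ ^ (q - 2) : ℝ) : ℂ)

lemma norm_mul_rpow_sub_two {q : ℝ} (hq : 1 < q) (c : ℂ) :
    ‖c‖ * ‖c‖ ^ (q - 2) = ‖c‖ ^ (q - 1) := by
  rcases (norm_nonneg c).eq_or_lt with h | h
  · rw [← h, zero_mul, Real.zero_rpow (by linarith)]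
  · rw [show q - 1 = 1 + (q - 2) by ring, Real.rpow_add h, Real.rpow_one]

/-- A continuous function is in `L^q` if it defines a bounded functional on the compactly supported
functions of the dual space. -/
lemma eLpNorm_le_of_forall_norm_integral_mul_le {p q : ℝ} (hpq : p.HolderConjugate q) {v : V → ℂ}
    (hv : Continuous v) {A : ℝ} (hA : 0 ≤ A)
    (h : ∀ g : V → ℂ, AEStronglyMeasurable g volume → HasCompactSupport g →
      (Integrable fun x => ‖g x‖ ^ p) →
      ‖∫ x, g x * v x‖ ≤ A * (∫ x, ‖g x‖ ^ p) ^ (1 / p)) :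
    eLpNorm v (ENNReal.ofReal q) volume ≤ ENNReal.ofReal A := by
  have hq1 : 1 < q := hpq.symm.lt
  have hq0 : 0 < q := hpq.symm.pos
  -- On a ball $N=\int|v|^q$ is finite by continuity. The extremal test function turns the
  -- hypothesis into $N\le A\,N^{1/p}$, in which $N^{1/p}$ may be cancelled; the balls then exhaust
  -- the space.
  have hball : ∀ R : ℝ, ∫⁻ x in Metric.closedBall (0 : V) R, ‖v x‖ₑ ^ q ≤
      ENNReal.ofReal (A ^ q) := by
    intro R
    set s := Metric.closedBall (0 : V) R
    have hs : MeasurableSet s := Metric.isClosed_closedBall.measurableSet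
    have hvq : Continuous fun x => ‖v x‖ ^ q := hv.norm.rpow_const fun _ => Or.inr hq0.le
    have hint : IntegrableOn (fun x => ‖v x‖ ^ q) s :=
      hvq.continuousOn.integrableOn_compact (isCompact_closedBall _ _)
    have hgm : AEStronglyMeasurable (dualFunction q R v) volume := by
      refine AEStronglyMeasurable.indicator (Measurable.aestronglyMeasurable ?_) hs
      have := hv.measurable
      exact (Complex.continuous_conj.measurable.comp this).mul
        (Complex.measurable_ofReal.comp (this.norm.pow_const _))
    have hgs : HasCompactSupport (dualFunction q R v) :=
      HasCompactSupport.intro (isCompact_closedBall (0 : V) R) fun x hx =>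
        Set.indicator_of_notMem hx _
    have hgp : (fun x => ‖dualFunction q R v x‖ ^ p) = s.indicator fun x => ‖v x‖ ^ q := by
      ext x
      by_cases hx : x ∈ s
      · rw [dualFunction, Set.indicator_of_mem hx, Set.indicator_of_mem hx, norm_mul,
          RCLike.norm_conj, Complex.norm_real, Real.norm_of_nonneg (by positivity),
          norm_mul_rpow_sub_two hq1, ← Real.rpow_mul (norm_nonneg _), hpq.symm.sub_one_mul_conj]
      · rw [dualFunction, Set.indicator_of_notMem hx, Set.indicator_of_notMem hx, norm_zero,
          Real.zero_rpow hpq.pos.ne']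
    have hgv : (fun x => dualFunction q R v x * v x) =
        s.indicator fun x => ((‖v x‖ ^ q : ℝ) : ℂ) := by
      ext x
      by_cases hx : x ∈ s
      · rw [dualFunction, Set.indicator_of_mem hx, Set.indicator_of_mem hx, mul_right_comm,
          Complex.conj_mul', ← Complex.ofReal_pow, ← Complex.ofReal_mul, pow_two, mul_assoc,
          norm_mul_rpow_sub_two hq1]
        congr 1
        rcases (norm_nonneg (v x)).eq_or_lt with h0 | h0
        · rw [← h0, zero_mul, Real.zero_rpow hq0.ne']
        · rw [Real.rpow_sub_one h0.ne']; field_simp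
      · rw [dualFunction, Set.indicator_of_notMem hx, Set.indicator_of_notMem hx, zero_mul]
    have key := h _ hgm hgs (by rw [hgp]; exact hint.integrable_indicator hs)
    rw [hgp, hgv, integral_indicator hs, integral_indicator hs, integral_complex_ofReal,
      Complex.norm_real, Real.norm_of_nonneg (by positivity)] at key
    set N : ℝ := ∫ x in s, ‖v x‖ ^ q with hN
    have hN0 : 0 ≤ N := by positivity
    have hNA : N ≤ A ^ q := by
      rcases hN0.eq_or_lt with h0 | h0
      · rw [← h0]; positivity
      · have e : N = N ^ (1 / q) * N ^ (1 / p) := by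
          rw [← Real.rpow_add h0, one_div, one_div, add_comm, hpq.inv_add_inv_eq_one,
            Real.rpow_one]
        rw [e] at key
        have h1 : N ^ (1 / q) ≤ A := by
          refine le_of_mul_le_mul_right ?_ (Real.rpow_pos_of_pos h0 (1 / p))
          rwa [← e] at key ⊢
        calc N = (N ^ (1 / q)) ^ q := by
              rw [← Real.rpow_mul hN0, one_div, inv_mul_cancel₀ hq0.ne', Real.rpow_one]
          _ ≤ A ^ q := Real.rpow_le_rpow (by positivity) h1 hq0.le
    refine le_trans (le_of_eq ?_) (ENNReal.ofReal_le_ofReal hNA)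
    rw [hN, ofReal_integral_eq_lintegral_ofReal hint
      (Eventually.of_forall fun x => by positivity)]
    refine lintegral_congr fun x => ?_
    rw [← ENNReal.ofReal_rpow_of_nonneg (norm_nonneg _) hq0.le, ofReal_norm]
  have hlint : ∫⁻ x, ‖v x‖ₑ ^ q ≤ ENNReal.ofReal (A ^ q) := by
    rw [← setLIntegral_univ, ← Metric.iUnion_closedBall_nat (0 : V),
      setLIntegral_iUnion_of_directed]
    · exact iSup_le fun k => hball k
    · exact directed_of_isDirected_le fun i j hij =>
        Metric.closedBall_subset_closedBall (by exact_mod_cast hij)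
  rw [eLpNorm_eq_lintegral_rpow_enorm_toReal (by simpa using hq0) ENNReal.ofReal_ne_top,
    ENNReal.toReal_ofReal hq0.le]
  calc _ ≤ (ENNReal.ofReal (A ^ q)) ^ (1 / q) := by gcongr
    _ = ENNReal.ofReal A := by
      rw [ENNReal.ofReal_rpow_of_nonneg (by positivity) (by positivity), ← Real.rpow_mul hA,
        mul_one_div_cancel hq0.ne', Real.rpow_one]

end Duality

/-! ### Linearity and removal of the normalisation -/

section Estimate

variable {V : Type*} [NormedAddCommGroup V] [InnerProductSpace ℝ V] [FiniteDimensional ℝ V]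
  [MeasurableSpace V] [BorelSpace V]

lemma integrable_mul_rieszKernel {f : V → ℂ} (hf : Integrable f) (hfs : HasCompactSupport f)
    (z : ℂ) (x : V) : Integrable fun y => f y * rieszKernel z (x - y) := by
  obtain ⟨M, hM⟩ := exists_norm_mul_rieszKernel_le hfs ‖z‖ ‖x‖
  exact (hf.norm.const_mul M).mono' (aestronglyMeasurable_mul_rieszKernel hf.1 z x)
    (Eventually.of_forall fun y => hM z le_rfl x le_rfl y)

lemma rieszPotential_add {f g : V → ℂ} (hf : Integrable f) (hfs : HasCompactSupport f)
    (hg : Integrable g) (hgs : HasCompactSupport g) (z : ℂ) :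
    rieszPotential z (f + g) = rieszPotential z f + rieszPotential z g := by
  ext x
  simp only [rieszPotential, Pi.add_apply, add_mul]
  exact integral_add (integrable_mul_rieszKernel hf hfs z x) (integrable_mul_rieszKernel hg hgs z x)

lemma rieszPotential_smul (c : ℂ) (f : V → ℂ) (z : ℂ) :
    rieszPotential z (c • f) = c • rieszPotential z f := by
  ext x
  simp only [rieszPotential, Pi.smul_apply, smul_eq_mul, mul_assoc]
  exact integral_const_mul _ _

lemma rieszPotential_eq_zero {f : V → ℂ} (hf : f =ᵐ[volume] 0) (z : ℂ) :
    rieszPotential z f = 0 := by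
  ext x
  refine integral_eq_zero_of_ae ?_
  filter_upwards [hf] with y hy
  simp [hy]

lemma ae_eq_zero_of_integral_norm_rpow_eq_zero {p : ℝ} (hp : 0 < p) {f : V → ℂ}
    (hi : Integrable fun x => ‖f x‖ ^ p) (h0 : ∫ x, ‖f x‖ ^ p = 0) : f =ᵐ[volume] 0 := by
  have h := (integral_eq_zero_iff_of_nonneg
    (fun x => Real.rpow_nonneg (norm_nonneg (f x)) p) hi).1 h0
  filter_upwards [h] with x hx
  exact norm_eq_zero.1 ((Real.rpow_eq_zero (norm_nonneg _) hp.ne').1 hx)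

lemma integral_norm_inv_smul_rpow {p : ℝ} (hp : 0 < p) {f : V → ℂ}
    (h0 : 0 < ∫ x, ‖f x‖ ^ p) :
    ∫ x, ‖((((∫ x, ‖f x‖ ^ p) ^ (1 / p))⁻¹ : ℝ) : ℂ) • f x‖ ^ p = 1 := by
  set N := ∫ x, ‖f x‖ ^ p
  have e : ∀ x, ‖(((N ^ (1 / p))⁻¹ : ℝ) : ℂ) • f x‖ ^ p = N⁻¹ * ‖f x‖ ^ p := fun x => by
    rw [norm_smul, Complex.norm_real, Real.norm_of_nonneg (by positivity),
      Real.mul_rpow (by positivity) (norm_nonneg _), Real.inv_rpow (by positivity),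
      ← Real.rpow_mul h0.le, one_div, inv_mul_cancel₀ hp.ne', Real.rpow_one]
  simp_rw [e]
  rw [integral_const_mul, inv_mul_cancel₀ h0.ne']

lemma integrable_of_memLp_of_hasCompactSupport {p : ℝ≥0∞} (hp : 1 ≤ p) {f : V → ℂ}
    (hf : MemLp f p) (hfs : HasCompactSupport f) : Integrable f := by
  have h := (hf.locallyIntegrable hp).integrableOn_isCompact hfs
  exact (integrableOn_iff_integrable_of_support_subset (subset_tsupport f)).1 h

variable [Nontrivial V]

/-- Interpolation of the analytic family `S̃ ^ z` between the lines `Re z = 0` and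
`Re z = -(n+1)/2`. -/
lemma norm_interpolationWeight_mul_integral_le {C : ℝ} (hC0 : 0 ≤ C)
    (hC : ∀ z : ℂ, -(((finrank ℝ V : ℝ) + 1) / 2) ≤ z.re → ∀ x : V,
      ‖interpolationWeight (finrank ℝ V) z * rieszKernel z x‖ ≤ C)
    {w : ℂ} (hw : -(((finrank ℝ V : ℝ) + 1) / 2) ≤ w.re) (hw0 : w.re ≤ 0) {p : ℝ} (hp0 : 0 < p)
    (hp : p / 2 * (1 - 2 * w.re / (finrank ℝ V + 1)) = 1) {f g : V → ℂ}
    (hfm : AEStronglyMeasurable f volume) (hfs : HasCompactSupport f)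
    (hfi : Integrable fun x => ‖f x‖ ^ p)
    (hgm : AEStronglyMeasurable g volume) (hgs : HasCompactSupport g)
    (hgi : Integrable fun x => ‖g x‖ ^ p) :
    ‖interpolationWeight (finrank ℝ V) w * ∫ x, g x * rieszPotential w f x‖ ≤
      max C 1 * (∫ x, ‖f x‖ ^ p) ^ (1 / p) * (∫ x, ‖g x‖ ^ p) ^ (1 / p) := by
  have hnn : ∀ h : V → ℂ, 0 ≤ ∫ x, ‖h x‖ ^ p := fun h => by positivity
  rcases (hnn f).eq_or_lt with hf0 | hf0
  · rw [rieszPotential_eq_zero (ae_eq_zero_of_integral_norm_rpow_eq_zero hp0 hfi hf0.symm)]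
    simp only [Pi.zero_apply, mul_zero, integral_zero, norm_zero]
    have := hnn g
    positivity
  rcases (hnn g).eq_or_lt with hg0 | hg0
  · have hg := ae_eq_zero_of_integral_norm_rpow_eq_zero hp0 hgi hg0.symm
    have : ∫ x, g x * rieszPotential w f x = 0 := by
      refine integral_eq_zero_of_ae ?_
      filter_upwards [hg] with x hx
      simp [hx]
    rw [this, mul_zero, norm_zero]
    positivity
  have hi : ∀ {h : V → ℂ} (c : ℂ), (Integrable fun x => ‖h x‖ ^ p) →
      Integrable fun x => ‖(c • h) x‖ ^ p := fun {h} c hh => by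
    simp only [Pi.smul_apply, norm_smul, Real.mul_rpow (norm_nonneg _) (norm_nonneg _)]
    exact hh.const_mul _
  set a : ℝ := (∫ x, ‖f x‖ ^ p) ^ (1 / p) with ha
  set b : ℝ := (∫ x, ‖g x‖ ^ p) ^ (1 / p) with hb
  have ha0 : 0 < a := by positivity
  have hb0 : 0 < b := by positivity
  -- Both functions now have positive norm; dividing by it reduces to the normalised case.
  have key := norm_interpolationWeight_mul_integral_le_of_integral_eq_one hC0 hC hw hw0 hp0 hp
    (hfm.const_smul ((a⁻¹ : ℝ) : ℂ)) (hfs.smul_left (f := fun _ : V => ((a⁻¹ : ℝ) : ℂ))) (hi _ hfi)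
    (integral_norm_inv_smul_rpow hp0 hf0)
    (hgm.const_smul ((b⁻¹ : ℝ) : ℂ)) (hgs.smul_left (f := fun _ : V => ((b⁻¹ : ℝ) : ℂ))) (hi _ hgi)
    (integral_norm_inv_smul_rpow hp0 hg0)
  rw [rieszPotential_smul] at key
  have e : ∫ x, (((b⁻¹ : ℝ) : ℂ) • g) x * (((a⁻¹ : ℝ) : ℂ) • rieszPotential w f) x =
      ((b⁻¹ * a⁻¹ : ℝ) : ℂ) * ∫ x, g x * rieszPotential w f x := by
    rw [← integral_const_mul]
    refine integral_congr_ae (Eventually.of_forall fun x => ?_)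
    simp only [Pi.smul_apply, smul_eq_mul]
    push_cast
    ring
  have key' : ‖((b⁻¹ * a⁻¹ : ℝ) : ℂ) * (interpolationWeight (finrank ℝ V) w *
      ∫ x, g x * rieszPotential w f x)‖ ≤ max C 1 := by
    rw [mul_left_comm, ← e]
    exact key
  rw [norm_mul, Complex.norm_real, Real.norm_of_nonneg (by positivity), ← mul_inv,
    inv_mul_le_iff₀ (by positivity)] at key'
  linarith

end Estimate

/-! ### The exponents and the estimate for compact support -/

section Exponents

variable {n : ℕ} {β : ℝ}

lemma sourceExponent_eq (hβ : 0 < β) :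
    sourceExponent n β = ENNReal.ofReal ((2 * n + 2) / (n + 1 + 4 * β)) := by
  rw [sourceExponent, ENNReal.ofReal_div_of_pos (by positivity)]

lemma one_le_sourceExponent (hβ : 0 < β) (hβ₃ : β ≤ ((n : ℝ) + 1) / 4) :
    1 ≤ sourceExponent n β := by
  rw [sourceExponent_eq hβ, ← ENNReal.ofReal_one]
  refine ENNReal.ofReal_le_ofReal ?_
  rw [le_div_iff₀ (by positivity)]
  linarith

lemma targetExponent_eq_top (hβ : β = ((n : ℝ) + 1) / 4) : targetExponent n β = ∞ := by
  have h : (n : ℝ) + 1 - 4 * β = 0 := by rw [hβ]; ring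
  rw [targetExponent, h, ENNReal.ofReal_zero]
  refine ENNReal.div_zero ?_
  rw [ne_eq, ENNReal.ofReal_eq_zero]
  have : (0 : ℝ) ≤ n := n.cast_nonneg
  linarith

lemma targetExponent_eq (hβ : β < ((n : ℝ) + 1) / 4) :
    targetExponent n β = ENNReal.ofReal ((2 * n + 2) / (n + 1 - 4 * β)) := by
  rw [targetExponent, ENNReal.ofReal_div_of_pos (by linarith)]

lemma one_le_targetExponent (hβ : 0 < β) (hβ₃ : β ≤ ((n : ℝ) + 1) / 4) :
    1 ≤ targetExponent n β := by
  rcases hβ₃.eq_or_lt with h | h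
  · rw [targetExponent_eq_top h]; exact le_top
  · rw [targetExponent_eq h, ← ENNReal.ofReal_one]
    refine ENNReal.ofReal_le_ofReal ?_
    rw [le_div_iff₀ (by linarith)]
    have : (0 : ℝ) ≤ n := n.cast_nonneg
    linarith

lemma holderConjugate_exponents (hβ : 0 < β) (hβ₃ : β < ((n : ℝ) + 1) / 4) :
    ((2 * n + 2 : ℝ) / (n + 1 + 4 * β)).HolderConjugate ((2 * n + 2) / (n + 1 - 4 * β)) := by
  rw [Real.holderConjugate_iff]
  constructor
  · rw [lt_div_iff₀ (by positivity)]; linarith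
  · have h1 : (n : ℝ) + 1 - 4 * β ≠ 0 := by linarith
    have h2 : (n : ℝ) + 1 + 4 * β ≠ 0 := by positivity
    rw [inv_div, inv_div]
    field_simp
    ring

end Exponents

/-- The `L^p → L^q` estimate of `S̃ ^ z` on functions with compact support. -/
lemma exists_eLpNorm_rieszPotential_le {n : ℕ} (hn : 1 ≤ n) {β : ℝ} (hβ : 0 < β)
    (hβ₃ : β ≤ ((n : ℝ) + 1) / 4) :
    ∃ M : ℝ, 0 ≤ M ∧ ∀ μ : ℝ, ∀ f : EuclideanSpace ℝ (Fin n) → ℂ,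
      MemLp f (sourceExponent n β) → HasCompactSupport f →
      eLpNorm (rieszPotential (-2 * (β : ℂ) + μ * Complex.I) f) (targetExponent n β) volume ≤
        ENNReal.ofReal (M / ‖interpolationWeight n (-2 * (β : ℂ) + μ * Complex.I)‖ *
          (eLpNorm f (sourceExponent n β) volume).toReal) := by
  have : NeZero n := ⟨by omega⟩
  have hn0 : (0 : ℝ) ≤ n := n.cast_nonneg
  obtain ⟨C, hC0, hC⟩ :=
    exists_norm_interpolationWeight_mul_rieszKernel_le (EuclideanSpace ℝ (Fin n))
  have hfr : finrank ℝ (EuclideanSpace ℝ (Fin n)) = n := finrank_euclideanSpace_fin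
  refine ⟨max C 1, by positivity, fun μ f hf hfs => ?_⟩
  have hp1 := one_le_sourceExponent hβ hβ₃
  have hfi := integrable_of_memLp_of_hasCompactSupport hp1 hf hfs
  set w : ℂ := -2 * (β : ℂ) + μ * Complex.I with hw
  have hwre : w.re = -2 * β := by simp [hw]
  have hwσ : -(((n : ℝ) + 1) / 2) ≤ w.re := by rw [hwre]; linarith
  have hH := norm_pos_iff.2 (interpolationWeight_ne_zero hwσ)
  set H : ℝ := ‖interpolationWeight n w‖ with hHdef
  have hp0 : (0 : ℝ) < (2 * n + 2) / (n + 1 + 4 * β) := by positivity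
  have hnorm : (eLpNorm f (sourceExponent n β) volume).toReal =
      (∫ x, ‖f x‖ ^ ((2 * n + 2 : ℝ) / (n + 1 + 4 * β))) ^
        (1 / ((2 * n + 2 : ℝ) / (n + 1 + 4 * β))) := by
    rw [sourceExponent_eq hβ] at hf ⊢
    rw [hf.eLpNorm_eq_integral_rpow_norm (by simpa using hp0) ENNReal.ofReal_ne_top,
      ENNReal.toReal_ofReal hp0.le, ENNReal.toReal_ofReal (by positivity), one_div]
  rw [hnorm]
  -- At $\beta=\frac{n+1}4$ the point $w$ lies on the left edge of the strip, $p=1$ and $q=\infty$,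
  -- and the kernel bound applies directly. Otherwise $q<\infty$ and interpolation is combined with
  -- duality.
  rcases hβ₃.eq_or_lt with h | h
  · have hp : (2 * n + 2 : ℝ) / (n + 1 + 4 * β) = 1 := by
      rw [h]; field_simp; ring
    rw [targetExponent_eq_top h, hp]
    simp only [Real.rpow_one, one_div, inv_one]
    refine eLpNormEssSup_le_of_ae_bound (Eventually.of_forall fun x => ?_)
    rw [rieszPotential, div_mul_eq_mul_div, le_div_iff₀ hH, mul_comm, hHdef, ← norm_mul,
      ← integral_const_mul, ← integral_const_mul]
    refine norm_integral_le_of_norm_le (hfi.norm.const_mul _) (Eventually.of_forall fun y => ?_)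
    rw [mul_left_comm, norm_mul, mul_comm]
    refine mul_le_mul_of_nonneg_right (le_trans ?_ (le_max_left C 1)) (norm_nonneg _)
    have := hC w (by rw [hfr]; exact hwσ) (x - y)
    rwa [hfr] at this
  · rw [targetExponent_eq h]
    refine eLpNorm_le_of_forall_norm_integral_mul_le (holderConjugate_exponents hβ h)
      (continuous_rieszPotential hfi hfs w) (by positivity) fun g hgm hgs hgi => ?_
    have hfp : Integrable fun x => ‖f x‖ ^ ((2 * n + 2 : ℝ) / (n + 1 + 4 * β)) := by
      rw [sourceExponent_eq hβ] at hf
      have := hf.integrable_norm_rpow (by simpa using hp0) ENNReal.ofReal_ne_top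
      rwa [ENNReal.toReal_ofReal hp0.le] at this
    have key := norm_interpolationWeight_mul_integral_le hC0 hC (w := w)
      (by rw [hfr]; exact hwσ) (by rw [hwre]; linarith) hp0
      (by rw [hfr, hwre]; field_simp; ring) hf.1 hfs hfp hgm hgs hgi
    rw [hfr, norm_mul, ← hHdef] at key
    rw [div_mul_eq_mul_div, div_mul_eq_mul_div, le_div_iff₀ hH, mul_comm]
    exact key

/-! ### Extension to the whole space by density -/

/-- The functions of compact support in `L^p`. -/
def compactlySupportedMemLp (n : ℕ) (p : ℝ≥0∞) : Submodule ℂ (EuclideanSpace ℝ (Fin n) → ℂ) where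
  carrier := {f | MemLp f p volume ∧ HasCompactSupport f}
  add_mem' hf hg := ⟨hf.1.add hg.1, hf.2.add hg.2⟩
  zero_mem' := ⟨MemLp.zero, HasCompactSupport.zero⟩
  smul_mem' c _ hf := ⟨hf.1.const_smul c, hf.2.smul_left (f := fun _ => c)⟩

/-- The map of the functions of compact support to `L^p`. -/
def compactlySupportedToLp (n : ℕ) (p : ℝ≥0∞) : compactlySupportedMemLp n p →ₗ[ℂ]
    Lp ℂ p (volume : Measure (EuclideanSpace ℝ (Fin n))) where
  toFun f := f.2.1.toLp f.1
  map_add' f g := MemLp.toLp_add f.2.1 g.2.1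
  map_smul' c f := MemLp.toLp_const_smul c f.2.1

lemma denseRange_compactlySupportedToLp {n : ℕ} {p : ℝ≥0∞} [Fact (1 ≤ p)] (hp : p ≠ ∞) :
    DenseRange (compactlySupportedToLp n p) := by
  intro F
  rw [EMetric.mem_closure_iff]
  intro ε hε
  obtain ⟨δ, hδ0, hδ⟩ := exists_between hε
  obtain ⟨g, hgs, hge, -, hgp⟩ :=
    (Lp.memLp F).exists_hasCompactSupport_eLpNorm_sub_le hp hδ0.ne'
  refine ⟨_, ⟨⟨g, hgp, hgs⟩, rfl⟩, lt_of_le_of_lt ?_ hδ⟩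
  rw [Lp.edist_def]
  refine (eLpNorm_congr_ae ?_).trans_le hge
  filter_upwards [hgp.coeFn_toLp] with x hx
  simp only [Pi.sub_apply]
  congr 1

end

theorem mainTheorem5 (n : ℕ) (β : ℝ) (hβ₁ : 1 / 2 < β) (hβ₂ : β < 3 / 2)
    (hβ₃ : β ≤ ((n : ℝ) + 1) / 4) :
    ∃ C : ℝ, ∀ μ : ℝ,
      ∃ T : Lp ℂ (sourceExponent n β) (volume : Measure (EuclideanSpace ℝ (Fin n))) →ₗ[ℂ]
          Lp ℂ (targetExponent n β) (volume : Measure (EuclideanSpace ℝ (Fin n))),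
        ExtendsAnalyticBochnerRiesz (-2 * (β : ℂ) + μ * Complex.I) T ∧
        ∀ f, ‖bochnerRieszFactor (-2 * (β : ℂ) + μ * Complex.I) • T f‖ ≤
          C * (1 + |μ|) * ‖f‖ := by
  -- The constraints $\frac12<\beta\le\frac{n+1}4$ already force $n>1$.
  have hn : 1 ≤ n := by
    have : (1 : ℝ) < n := by linarith
    exact_mod_cast this.le
  have : NeZero n := ⟨by omega⟩
  have hβ : 0 < β := by linarith
  have hp1 := one_le_sourceExponent hβ hβ₃
  have : Fact (1 ≤ sourceExponent n β) := ⟨hp1⟩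
  have : Fact (1 ≤ targetExponent n β) := ⟨one_le_targetExponent hβ hβ₃⟩
  obtain ⟨M, hM0, hM⟩ := exists_eLpNorm_rieszPotential_le hn hβ hβ₃
  obtain ⟨C, hC0, hC⟩ := exists_norm_bochnerRieszFactor_le hn hβ₁ hβ₂ hβ₃
  refine ⟨C * M, fun μ => ?_⟩
  set w : ℂ := -2 * (β : ℂ) + μ * Complex.I with hw
  have hwre : w.re = -2 * β := by simp [hw]
  have hH := norm_pos_iff.2
    (interpolationWeight_ne_zero (n := n) (z := w) (by rw [hwre]; linarith))
  have hint : ∀ f : compactlySupportedMemLp n (sourceExponent n β), Integrable f.1 := fun f =>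
    integrable_of_memLp_of_hasCompactSupport hp1 f.2.1 f.2.2
  have hmem : ∀ f : compactlySupportedMemLp n (sourceExponent n β),
      MemLp (rieszPotential w f.1) (targetExponent n β) volume := fun f =>
    ⟨(continuous_rieszPotential (hint f) f.2.2 w).aestronglyMeasurable,
      (hM μ f.1 f.2.1 f.2.2).trans_lt ENNReal.ofReal_lt_top⟩
  let S : compactlySupportedMemLp n (sourceExponent n β) →ₗ[ℂ]
      Lp ℂ (targetExponent n β) (volume : Measure (EuclideanSpace ℝ (Fin n))) :=
    { toFun := fun f => (hmem f).toLp _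
      map_add' := fun f g => by
        rw [← MemLp.toLp_add]
        exact MemLp.toLp_congr _ _ (Eventually.of_forall fun x => congrFun
          (rieszPotential_add (hint f) f.2.2 (hint g) g.2.2 w) x)
      map_smul' := fun c f => by
        rw [RingHom.id_apply, ← MemLp.toLp_const_smul]
        exact MemLp.toLp_congr _ _ (Eventually.of_forall fun x => congrFun
          (rieszPotential_smul c f.1 w) x) }
  have hSb : ∀ f, ‖S f‖ ≤ M / ‖interpolationWeight n w‖ *
      ‖compactlySupportedToLp n (sourceExponent n β) f‖ := fun f => by
    have h1 : ‖S f‖ = (eLpNorm (rieszPotential w f.1) (targetExponent n β) volume).toReal :=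
      Lp.norm_toLp _ (hmem f)
    have h2 : ‖compactlySupportedToLp n (sourceExponent n β) f‖ =
        (eLpNorm f.1 (sourceExponent n β) volume).toReal := Lp.norm_toLp _ f.2.1
    rw [h1, h2]
    exact ENNReal.toReal_le_of_le_ofReal (by positivity) (hM μ f.1 f.2.1 f.2.2)
  have hdense := denseRange_compactlySupportedToLp (n := n) (p := sourceExponent n β)
    (by rw [sourceExponent_eq hβ]; exact ENNReal.ofReal_ne_top)
  -- The bound `hSb` in terms of the $L^p$ norm makes `S` independent of the representative, so it
  -- descends to a dense subspace and extends continuously. The weight cancels in the final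
  -- estimate.
  refine ⟨(S.extendOfNorm (compactlySupportedToLp n (sourceExponent n β))).toLinearMap, ?_, ?_⟩
  · intro f hf hfs
    refine ⟨rieszPotential w f, isAnalyticBochnerRiesz_rieszPotential hn
      (integrable_of_memLp_of_hasCompactSupport hp1 hf hfs) hfs w, ?_⟩
    have h := LinearMap.extendOfNorm_eq hdense ⟨_, hSb⟩ ⟨f, hf, hfs⟩
    have h' : (S.extendOfNorm (compactlySupportedToLp n (sourceExponent n β))).toLinearMap
        (hf.toLp f) = (hmem ⟨f, hf, hfs⟩).toLp _ := h
    rw [h']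
    exact MemLp.coeFn_toLp _
  · intro f
    have h := LinearMap.norm_extendOfNorm_apply_le hdense _ hSb f
    calc ‖bochnerRieszFactor w •
          (S.extendOfNorm (compactlySupportedToLp n (sourceExponent n β))).toLinearMap f‖
        = ‖bochnerRieszFactor w‖ *
          ‖S.extendOfNorm (compactlySupportedToLp n (sourceExponent n β)) f‖ := norm_smul _ _
      _ ≤ (C * (1 + |μ|) * ‖interpolationWeight n w‖) *
          (M / ‖interpolationWeight n w‖ * ‖f‖) :=
          mul_le_mul (hC μ) h (norm_nonneg _) (by positivity)
      _ = C * M * (1 + |μ|) * ‖f‖ := by field_simp
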